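/- Let $\mathbb{N}=\{1,2,\dots\}$, let $L\in\mathbb{N}$, $\ell_0,\ell_1,\dots,\ell_L\in\mathbb{N}$, and $d=\sum_{k=1}^L \ell_k(\ell_{k-1}+1)$. For every $A\in C(\mathbb{R},\mathbb{R})$ and $\theta=(\theta_1,\dots,\theta_d)\in\mathbb{R}^d$ let $\mathcal{N}_A^{k,\theta}=(\mathcal{N}^{k,\theta}_{A,1},\dots,\mathcal{N}^{k,\theta}_{A,\ell_k})\colon\mathbb{R}^{\ell_0}\to\mathbb{R}^{\ell_k}$, $k\in\{1,\dots,L\}$, be the realization functions of the fully-connected feedforward neural network with activation $A$ and parameters $\theta$, that is, for all $k\in\{0,\dots,L-1\}$, $x\in\mathbb{R}^{\ell_0}$, $i\in\{1,\dots,\ell_{k+1}\}$, $$\mathcal{N}^{k+1,\theta}_{A,i}(x)=\theta_{\mathbf d_k+\ell_{k+1}\ell_k+i}+\sum_{j=1}^{\ell_k}\theta_{\mathbf d_k+(i-1)\ell_k+j}\,\xi_{k,j},\qquad \mathbf d_k=\sum_{h=1}^{k}\ell_h(\ell_{h-1}+1),$$ where $\xi_{0,j}=x_j$ and $\xi_{k,j}=A(\mathcal{N}^{k,\theta}_{A,j}(x))$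 for $k\ge1$. Let $\mu$ be a finite Borel measure on $\mathbb{R}^{\ell_0}\times\mathbb{R}^{\ell_L}$ such that $\{x\in\mathbb{R}^{\ell_0}\colon \exists\, y\in\mathbb{R}^{\ell_L}\colon (x,y)\in\operatorname{supp}(\mu)\}$ is bounded. Let $H\in C^1(\mathbb{R}^{\ell_L}\times\mathbb{R}^{\ell_L}\times\mathbb{R}^d,\mathbb{R})$, $H=H(x,y,\theta)$, satisfy $\int|H(\mathcal{N}^{L,\theta}_A(x),y,\theta)|\,\mu(dx,dy)<\infty$ for all $A\in C(\mathbb{R},\mathbb{R})$, $\theta\in\mathbb{R}^d$, and set $\mathcal{L}_A(\theta)=\int H(\mathcal{N}^{L,\theta}_A(x),y,\theta)\,\mu(dx,dy)$. Assume for all $r\in(0,\infty)$, $X\in[-r,r]^{\ell_L}$, $\Theta\in[-r,r]^d$ that $$\sup_{x\in[-r,r]^{\ell_L}}\ \sup_{(u,y)\in\operatorname{supp}(\mu)}\ \sup_{\theta\in[-r,r]^d}\ \frac{\|\nabla_xH(x,y,\theta)\|+\|\nabla_\theta H(x,y,\theta)\|}{1+|H(X,y,\Theta)|}<\infty.$$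 Let $S\subseteq\mathbb{R}$ be finite, let $\mathscr{A}\in C(\mathbb{R},\mathbb{R})$ satisfy $\mathscr{A}|_{\mathbb{R}\setminus S}\in C^1(\mathbb{R}\setminus S,\mathbb{R})$, and let $\mathscr{a}\colon\mathbb{R}\to\mathbb{R}$ satisfy $\mathscr{a}(x)=\mathscr{A}'(x)$ for all $x\in\mathbb{R}\setminus S$ and $$\min_{\sigma\in\{-1,1\}}\ \sum_{s\in S}\ \limsup_{h\searrow0}|\mathscr{a}(s+\sigma h)-\mathscr{a}(s)|=0 .$$ Let $z\in\mathbb{N}_0$, let $w=z$ if $\operatorname{supp}(\mu)$ is a finite set and $w=z+1$ otherwise, and assume for all $m\in\mathbb{N}$ that $\sup_{x\in[-m,m]}\bigl(|\mathscr{a}(x)|\,w\bigr)<\infty$. For continuous $f\colon\mathbb{R}^d\to\mathbb{R}$ and $\theta\in\mathbb{R}^d$ let $(\mathcal{D}f)(\theta)$ be the set of all $v\in\mathbb{R}^d$ with $\liminf_{0\ne h\to0}\frac{f(\theta+h)-f(\theta)-\langle v,h\rangle}{\|h\|}\ge0$ (Fréchet subgradients), and let $(\mathbb{D}f)(\theta)=\bigcap_{\varepsilon>0}\overline{\bigcup_{\|\vartheta-\theta\|<\varepsilon}(\mathcal{D}f)(\vartheta)}$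 (limiting Fréchet subgradients). Then (i) $\mathcal{L}_A\in C^1(\mathbb{R}^d,\mathbb{R})$ for all $A\in C^1(\mathbb{R},\mathbb{R})$; (ii) there exists a unique $\mathcal{G}\colon\mathbb{R}^d\to\mathbb{R}^d$ such that for all $\theta\in\mathbb{R}^d$ and all sequences $(A_n)_{n\in\mathbb{N}}\subseteq C^1(\mathbb{R},\mathbb{R})$ which satisfy $\forall x\in\mathbb{R}\ \exists m\in\mathbb{N}\colon \sum_{n=m}^\infty\bigl(|\mathscr{A}(x)-A_n(x)|+|\mathscr{a}(x)-(A_n)'(x)|\bigr)=0$ and $\forall m\in\mathbb{N}\colon \sup_{n\in\mathbb{N}}\sup_{x\in[-m,m]}\bigl[(|A_n(x)|+|(A_n)'(x)|)\,w\bigr]<\infty$ it holds that $\limsup_{n\to\infty}\|(\nabla\mathcal{L}_{A_n})(\theta)-\mathcal{G}(\theta)\|=0$; (iii) $\mathcal{G}(\theta)\in(\mathbb{D}\mathcal{L}_{\mathscr{A}})(\theta)$ for all $\theta\in\mathbb{R}^d$; and (iv) $\mathcal{G}(\theta)=(\nabla\mathcal{L}_{\mathscr{A}})(\theta)$ for all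 open $U\subseteq\mathbb{R}^d$ with $\mathcal{L}_{\mathscr{A}}|_U\in C^1(U,\mathbb{R})$ and all $\theta\in U$. -/

import Mathlib

open Filter Topology MeasureTheory
open scoped ENNReal Gradient

noncomputable section

namespace DeepANN

/-- `paramDim ℓ k = ∑_{h=1}^{k} ℓ_h (ℓ_{h-1} + 1)`: the number of real parameters in the first `k`
layers of a fully-connected feedforward network with layer widths `ℓ 0, ℓ 1, …`. -/
def paramDim (ℓ : ℕ → ℕ) (k : ℕ) : ℕ :=
  ∑ h ∈ Finset.range k, ℓ (h + 1) * (ℓ h + 1)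

/-- The space `ℝ^{ℓ_k}` (Euclidean norm) in which the `k`-th layer takes its values. -/
abbrev Layer (ℓ : ℕ → ℕ) (k : ℕ) : Type := EuclideanSpace ℝ (Fin (ℓ k))

/-- The parameter space `ℝ^d` (Euclidean norm), `d = ∑_{h=1}^{L} ℓ_h (ℓ_{h-1} + 1)`. -/
abbrev Param (ℓ : ℕ → ℕ) (L : ℕ) : Type := EuclideanSpace ℝ (Fin (paramDim ℓ L))

/-- The `n`-th entry (counted from `0`) of a vector of `ℝ^d`. The value `0` for `n ≥ d` only makes
the function total: by `weightIdx_lt` and `biasIdx_lt` it is not used in layers `1, …, L`. -/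
def entry {d : ℕ} (θ : EuclideanSpace ℝ (Fin d)) (n : ℕ) : ℝ :=
  if h : n < d then θ ⟨n, h⟩ else 0

/-- Position (from `0`) of the weight from neuron `j` of layer `k` to neuron `i` of layer `k + 1`
(neurons counted from `0`). -/
def weightIdx (ℓ : ℕ → ℕ) (k i j : ℕ) : ℕ := paramDim ℓ k + (i * ℓ k + j)

/-- Position (from `0`) of the bias of neuron `i` of layer `k + 1` (neurons counted from `0`). -/
def biasIdx (ℓ : ℕ → ℕ) (k i : ℕ) : ℕ := paramDim ℓ k + (ℓ (k + 1) * ℓ k + i)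

theorem paramDim_succ_le (ℓ : ℕ → ℕ) {k L : ℕ} (hk : k < L) :
    paramDim ℓ k + ℓ (k + 1) * (ℓ k + 1) ≤ paramDim ℓ L := by
  have h : paramDim ℓ (k + 1) ≤ paramDim ℓ L :=
    Finset.sum_le_sum_of_subset (Finset.range_mono hk)
  have h' : paramDim ℓ (k + 1) = paramDim ℓ k + ℓ (k + 1) * (ℓ k + 1) :=
    Finset.sum_range_succ _ _
  omega

theorem weightIdx_lt (ℓ : ℕ → ℕ) {k L : ℕ} (hk : k < L) (i : Fin (ℓ (k + 1))) (j : Fin (ℓ k)) :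
    weightIdx ℓ k i j < paramDim ℓ L := by
  have h := paramDim_succ_le ℓ hk
  have hi := i.isLt
  have hj := j.isLt
  unfold weightIdx
  nlinarith

theorem biasIdx_lt (ℓ : ℕ → ℕ) {k L : ℕ} (hk : k < L) (i : Fin (ℓ (k + 1))) :
    biasIdx ℓ k i < paramDim ℓ L := by
  have h := paramDim_succ_le ℓ hk
  have hi := i.isLt
  unfold biasIdx
  nlinarith

/-- The realization `𝒩_A^{k,θ}(x) ∈ ℝ^{ℓ_k}` of the first `k` layers with activation `A`: layer `1`
is an affine function of the input `x`, layer `k + 1` is an affine function of the activation `A`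
applied entrywise to layer `k` (for `k ≥ 1`). Layer `0` is the input itself. -/
def realization (ℓ : ℕ → ℕ) {d : ℕ} (A : ℝ → ℝ) (θ : EuclideanSpace ℝ (Fin d)) (x : Layer ℓ 0) :
    (k : ℕ) → Layer ℓ k
  | 0 => x
  | k + 1 => WithLp.toLp 2 fun i : Fin (ℓ (k + 1)) =>
      entry θ (biasIdx ℓ k i) +
        ∑ j : Fin (ℓ k), entry θ (weightIdx ℓ k i j) *
          (if k = 0 then realization ℓ A θ x k j else A (realization ℓ A θ x k j))

/-- The integrand `(x, y) ↦ H(𝒩_A^{L,θ}(x), y, θ)` of the risk. -/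
def lossAt (ℓ : ℕ → ℕ) (L : ℕ) (H : Layer ℓ L × Layer ℓ L × Param ℓ L → ℝ) (A : ℝ → ℝ)
    (θ : Param ℓ L) (p : Layer ℓ 0 × Layer ℓ L) : ℝ :=
  H (realization ℓ A θ p.1 L, p.2, θ)

/-- The risk `ℒ_A(θ) = ∫ H(𝒩_A^{L,θ}(x), y, θ) μ(dx, dy)`. -/
def risk (ℓ : ℕ → ℕ) (L : ℕ) (H : Layer ℓ L × Layer ℓ L × Param ℓ L → ℝ)
    (μ : Measure (Layer ℓ 0 × Layer ℓ L)) (A : ℝ → ℝ) (θ : Param ℓ L) : ℝ :=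
  ∫ p, lossAt ℓ L H A θ p ∂μ

/-- The growth condition: for all `r > 0` and all `X`, `Θ` with entries in `[-r, r]`, the quotient
`(‖∇_x H(x, y, θ)‖ + ‖∇_θ H(x, y, θ)‖) / (1 + |H(X, y, Θ)|)` is bounded, over all `x`, `θ` with
entries in `[-r, r]` and all outputs `y` that occur in the support of `μ`. -/
def GradGrowth (ℓ : ℕ → ℕ) (L : ℕ) (H : Layer ℓ L × Layer ℓ L × Param ℓ L → ℝ)
    (μ : Measure (Layer ℓ 0 × Layer ℓ L)) : Prop :=
  ∀ r : ℝ, 0 < r → ∀ (X : Layer ℓ L) (Θ : Param ℓ L), (∀ i, |X i| ≤ r) → (∀ i, |Θ i| ≤ r) →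
    ∃ C : ℝ, ∀ (x : Layer ℓ L) (u : Layer ℓ 0) (y : Layer ℓ L) (θ : Param ℓ L),
      (∀ i, |x i| ≤ r) → (∀ i, |θ i| ≤ r) → (u, y) ∈ μ.support →
      (‖∇ (fun x' => H (x', y, θ)) x‖ + ‖∇ (fun θ' => H (x, y, θ')) θ‖) / (1 + |H (X, y, Θ)|) ≤ C

/-- `∑_{s ∈ S} limsup_{h ↘ 0} |a(s + σ h) - a(s)|`, as an element of `[0, ∞]`. -/
def oneSidedOsc (a : ℝ → ℝ) (S : Finset ℝ) (σ : ℝ) : ℝ≥0∞ :=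
  ∑ s ∈ S, limsup (fun h : ℝ => ‖a (s + σ * h) - a s‖ₑ) (𝓝[>] 0)

/-- `z + 𝟙_{∞}(|supp μ|)`: equal to `z` if the support of `μ` is finite and to `z + 1` if not. -/
def boundWeight {E : Type*} [TopologicalSpace E] [MeasurableSpace E] (z : ℕ) (μ : Measure E) : ℝ :=
  z + ({⊤} : Set ℕ∞).indicator (fun _ => (1 : ℝ)) μ.support.encard

/-- The approximating sequences: all `A n` are `C¹`, at every `x` the pair `(A n x, (A n)' x)`
is eventually equal to `(g x, a x)`, and `(|A n x| + |(A n)' x|) * w` is bounded in `n` and `x`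
on every interval `[-m, m]`. -/
structure IsApprox (g a : ℝ → ℝ) (w : ℝ) (A : ℕ → ℝ → ℝ) : Prop where
  contDiff : ∀ n, ContDiff ℝ 1 (A n)
  eventually_eq : ∀ x, ∃ m : ℕ,
    ∑' n : ℕ, (‖g x - A (m + n) x‖ₑ + ‖a x - deriv (A (m + n)) x‖ₑ) = 0
  bounded : ∀ m : ℕ, ∃ C : ℝ, ∀ n, ∀ x ∈ Set.Icc (-(m : ℝ)) m,
    (|A n x| + |deriv (A n) x|) * w ≤ C

/-- `G` is the limit of the gradients `∇ℒ_{A n}` for every approximating sequence `A`. -/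
def IsGenGradient (ℓ : ℕ → ℕ) (L : ℕ) (H : Layer ℓ L × Layer ℓ L × Param ℓ L → ℝ)
    (μ : Measure (Layer ℓ 0 × Layer ℓ L)) (g a : ℝ → ℝ) (w : ℝ) (G : Param ℓ L → Param ℓ L) :
    Prop :=
  ∀ (θ : Param ℓ L) (A : ℕ → ℝ → ℝ), IsApprox g a w A →
    Tendsto (fun n => ‖∇ (risk ℓ L H μ (A n)) θ - G θ‖) atTop (𝓝 0)

/-- The set of Fréchet subgradients of `f` at `x`. -/
def frechetSubgradients {n : ℕ} (f : EuclideanSpace ℝ (Fin n) → ℝ)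
    (x : EuclideanSpace ℝ (Fin n)) : Set (EuclideanSpace ℝ (Fin n)) :=
  {y | 0 ≤ liminf (fun h : EuclideanSpace ℝ (Fin n) =>
    (((f (x + h) - f x - inner ℝ y h) / ‖h‖ : ℝ) : EReal)) (𝓝[≠] 0)}

/-- The set of limiting Fréchet subgradients of `f` at `x`. -/
def limitingSubgradients {n : ℕ} (f : EuclideanSpace ℝ (Fin n) → ℝ)
    (x : EuclideanSpace ℝ (Fin n)) : Set (EuclideanSpace ℝ (Fin n)) :=
  ⋂ ε : ℝ, ⋂ _ : 0 < ε, closure (⋃ y ∈ {z | ‖x - z‖ < ε}, frechetSubgradients f y)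

end DeepANN

end

/-!
Differentiating the loss by the chain rule, with `a` in place of the derivative of the activation
`g`, and integrating gives the candidate `𝒢`. If `A n` and its derivative are eventually equal to
`g` and `a` at each point, the gradients of the smooth risks converge to `𝒢` by dominated
convergence. Such `A n` exist: `a` is continuous at every kink from one common side, so it is enough
to replace `g` near each kink, on the other side only, by the tangent line with slope `a s`.

For (iii) and (iv), call a parameter generic if almost no data point sends a preactivation into `S`.
At generic parameters the risk of `g` is differentiable with gradient `𝒢`, and almost every
parameter is generic, because for each data point only countably many bias shifts produce a value
in `S`. Shifting the biases layer by layer moves every preactivation strictly towards the side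
from which `a` is continuous. Thus every `θ` is the limit of generic parameters along which `𝒢`
converges to `𝒢 θ`.
-/

noncomputable section

namespace DeepANN

theorem exists_norm_le_of_continuous {E F : Type*} [NormedAddCommGroup E] [ProperSpace E]
    [NormedAddCommGroup F] {f : E → F} (hf : Continuous f) (r : ℝ) :
    ∃ C, ∀ x, ‖x‖ ≤ r → ‖f x‖ ≤ C := by
  obtain ⟨C, hC⟩ := (isCompact_closedBall (0 : E) r).exists_bound_of_continuousOn hf.continuousOn
  exact ⟨C, fun x hx => hC x (mem_closedBall_zero_iff.2 hx)⟩

section FiniteSupport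

variable {E V : Type*} [TopologicalSpace E] [HereditarilyLindelofSpace E] [MeasurableSpace E]
  [MeasurableSingletonClass E] {ν : Measure E} [IsFiniteMeasure ν] [NormedAddCommGroup V]
  [NormedSpace ℝ V] [CompleteSpace V]

theorem integral_eq_sum_of_finite_support (h : ν.support.Finite) (f : E → V) :
    ∫ p, f p ∂ν = ∑ p ∈ h.toFinset, ν.real {p} • f p := by
  have hae : ∀ᵐ p ∂ν, p ∈ (h.toFinset : Set E) := by
    simpa using (Measure.support_mem_ae : ν.support ∈ ae ν)
  rw [← setIntegral_finset _ IntegrableOn.finset, Measure.restrict_eq_self_of_ae_mem hae]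

theorem tendsto_integral_of_finite_support_or_dominated {F : ℕ → E → V} {f : E → V} {b : E → ℝ}
    (hmeas : ∀ n, AEStronglyMeasurable (F n) ν) (hb : Integrable b ν)
    (hlim : ∀ p ∈ ν.support, Tendsto (fun n => F n p) atTop (𝓝 (f p)))
    (h : ν.support.Finite ∨ ∃ C : ℝ, ∀ n, ∀ p ∈ ν.support, ‖F n p‖ ≤ C * b p) :
    Tendsto (fun n => ∫ p, F n p ∂ν) atTop (𝓝 (∫ p, f p ∂ν)) := by
  have hae : ∀ᵐ p ∂ν, p ∈ ν.support := Measure.support_mem_ae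
  rcases h with h | ⟨C, hC⟩
  · simp only [integral_eq_sum_of_finite_support h]
    exact tendsto_finsetSum _ fun p hp => (hlim p (h.mem_toFinset.1 hp)).const_smul _
  · exact tendsto_integral_of_dominated_convergence (fun p => C * b p) hmeas (hb.const_mul C)
      (fun n => hae.mono fun p hp => hC n p hp) (hae.mono hlim)

theorem hasFDerivAt_integral_of_finite_support {X : Type*} [NormedAddCommGroup X] [NormedSpace ℝ X]
    (h : ν.support.Finite) {F : X → E → V} {F' : E → X →L[ℝ] V} {x : X}
    (hF : ∀ᵐ p ∂ν, HasFDerivAt (fun y => F y p) (F' p) x) :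
    HasFDerivAt (fun y => ∫ p, F y p ∂ν) (∫ p, F' p ∂ν) x := by
  simp only [integral_eq_sum_of_finite_support h]
  refine HasFDerivAt.fun_sum fun p _ => ?_
  by_cases hp : ν {p} = 0
  · simpa [Measure.real, hp] using hasFDerivAt_const (0 : V) x
  · obtain ⟨q, hq, hqF⟩ := ((frequently_ae_mem_iff.2 hp).and_eventually hF).exists
    obtain rfl := Set.mem_singleton_iff.1 hq
    exact hqF.fun_const_smul (ν.real {q})

end FiniteSupport

section Subgradients

variable {n : ℕ} {f : EuclideanSpace ℝ (Fin n) → ℝ} {v x : EuclideanSpace ℝ (Fin n)}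

theorem mem_frechetSubgradients_of_hasGradientAt (h : HasGradientAt f v x) :
    v ∈ frechetSubgradients f x := by
  have hlim : Tendsto (fun h : EuclideanSpace ℝ (Fin n) =>
      (f (x + h) - f x - inner ℝ v h) / ‖h‖) (𝓝[≠] 0) (𝓝 0) :=
    (hasGradientAt_iff_isLittleO_nhds_zero.1 h).norm_right.tendsto_div_nhds_zero.mono_left
      nhdsWithin_le_nhds
  rcases (𝓝[≠] (0 : EuclideanSpace ℝ (Fin n))).eq_or_neBot with hbot | hne
  · simp [frechetSubgradients, hbot]
  · exact (EReal.tendsto_coe.2 hlim).liminf_eq.ge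

theorem mem_limitingSubgradients_of_tendsto {vs xs : ℕ → EuclideanSpace ℝ (Fin n)}
    (h : ∀ m, HasGradientAt f (vs m) (xs m)) (hx : Tendsto xs atTop (𝓝 x))
    (hv : Tendsto vs atTop (𝓝 v)) : v ∈ limitingSubgradients f x := by
  refine Set.mem_iInter₂.2 fun ε hε => mem_closure_of_tendsto hv ?_
  filter_upwards [(hx.const_sub x).norm.eventually (gt_mem_nhds (by simpa using hε))] with m hm
  exact Set.mem_biUnion hm (mem_frechetSubgradients_of_hasGradientAt (h m))

end Subgradients

theorem hasGradientAt_of_tendsto {E : Type*} [NormedAddCommGroup E] [InnerProductSpace ℝ E]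
    [CompleteSpace E] {f : E → ℝ} {v x : E} {U : Set E} (hU : IsOpen U) (hf : ContDiffOn ℝ 1 f U)
    (hxU : x ∈ U) {vs xs : ℕ → E} (h : ∀ m, HasGradientAt f (vs m) (xs m))
    (hx : Tendsto xs atTop (𝓝 x)) (hv : Tendsto vs atTop (𝓝 v)) : HasGradientAt f v x := by
  have hd : DifferentiableAt ℝ f x :=
    (hf.differentiableOn one_ne_zero).differentiableAt (hU.mem_nhds hxU)
  have hc : ContinuousAt (fderiv ℝ f) x :=
    (hf.continuousOn_fderiv_of_isOpen hU le_rfl).continuousAt (hU.mem_nhds hxU)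
  have hderiv : Tendsto (fun m => InnerProductSpace.toDual ℝ E (vs m)) atTop (𝓝 (fderiv ℝ f x)) :=
    (hc.tendsto.comp hx).congr fun m => (h m).hasFDerivAt.fderiv
  have hdual := ((InnerProductSpace.toDual ℝ E).continuous.tendsto v).comp hv
  rw [hasGradientAt_iff_hasFDerivAt, tendsto_nhds_unique hdual hderiv]
  exact hd.hasFDerivAt

section CountableExceptions

variable {f f' : ℝ → ℝ} {S : Set ℝ}

theorem hasDerivAt_of_forall_notMem_countable (hS : S.Countable) (hf : Continuous f)
    (hf' : Continuous f') (h : ∀ x ∉ S, HasDerivAt f (f' x) x) (x : ℝ) :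
    HasDerivAt f (f' x) x := by
  have hftc : f = fun y => f 0 + ∫ t in (0 : ℝ)..y, f' t := funext fun y => by
    rw [integral_eq_of_hasDerivAt_off_countable f f' hS hf.continuousOn (fun t ht => h t ht.2)
      (hf'.intervalIntegrable 0 y)]
    ring
  rw [hftc]
  exact (hf'.integral_hasStrictDerivAt 0 x).hasDerivAt.const_add _

theorem abs_sub_le_mul_of_hasDerivAt_off_countable (hS : S.Countable) (hf : Continuous f)
    (h : ∀ x ∉ S, HasDerivAt f (f' x) x) {C x y : ℝ} (hC : ∀ t ∈ Set.uIcc x y, |f' t| ≤ C) :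
    |f y - f x| ≤ C * |y - x| := by
  have hbound : ∀ᵐ t, t ∈ Set.uIoc x y → ‖deriv f t‖ ≤ C := by
    filter_upwards [hS.ae_notMem volume] with t ht hxy
    rw [(h t ht).deriv]
    exact hC t (Set.uIoc_subset_uIcc hxy)
  have hint : IntervalIntegrable (deriv f) volume x y :=
    (intervalIntegrable_const (c := C)).mono_fun (aestronglyMeasurable_deriv f _) <|
      (ae_restrict_iff' measurableSet_uIoc).2 <| hbound.mono fun t ht hxy =>
        (ht hxy).trans (le_abs_self C)
  rw [← integral_eq_of_hasDerivAt_off_countable f (deriv f) hS hf.continuousOn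
    (fun t ht => (h t ht.2).differentiableAt.hasDerivAt) hint]
  exact intervalIntegral.norm_integral_le_of_norm_le_const_ae hbound

end CountableExceptions

/-- `f` is bounded by `b r` on `[-r, r]`, for every `r`. -/
def HasLocalBound (b f : ℝ → ℝ) : Prop := ∀ r y : ℝ, |y| ≤ r → |f y| ≤ b r

/-- `g` is continuous and has the continuous derivative `a` off the finite set `S`, and at the
points of `S` the function `a` is continuous from the side given by the sign of `σ`. -/
structure IsOneSidedDeriv (S : Finset ℝ) (σ : ℝ) (g a : ℝ → ℝ) : Prop where
  sign_ne_zero : σ ≠ 0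
  continuous : Continuous g
  hasDerivAt : ∀ x ∉ S, HasDerivAt g (a x) x
  continuousAt : ∀ x ∉ S, ContinuousAt a x
  continuousWithinAt : ∀ s, ContinuousWithinAt a {y | 0 < σ * (y - s)} s

/-- The difference between the tangent line `g s + a s (x - s)` and `g`, on the side of `s`
opposite to the sign of `σ`; zero on the other side. -/
def tangentGap (g a : ℝ → ℝ) (σ s x : ℝ) : ℝ :=
  if σ * (x - s) < 0 then g s + a s * (x - s) - g x else 0

/-- The derivative of `tangentGap` away from the points where `g` is not differentiable. -/
def tangentGapDeriv (a : ℝ → ℝ) (σ s x : ℝ) : ℝ :=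
  if σ * (x - s) < 0 then a s - a x else 0

section TangentGap

variable {S : Finset ℝ} {g a : ℝ → ℝ} {σ s x : ℝ}

theorem eventually_mul_sub_neg_iff (hσ : σ ≠ 0) (hxs : x ≠ s) :
    ∀ᶠ y in 𝓝 x, (σ * (y - s) < 0 ↔ σ * (x - s) < 0) := by
  have hc : ContinuousAt (fun y => σ * (y - s)) x := by fun_prop
  rcases lt_or_gt_of_ne (mul_ne_zero hσ (sub_ne_zero.2 hxs)) with h | h
  · exact (hc.eventually (gt_mem_nhds h)).mono fun y hy => iff_of_true hy h
  · exact (hc.eventually (lt_mem_nhds h)).mono fun y hy => iff_of_false hy.not_gt h.not_gt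

theorem IsOneSidedDeriv.continuous_tangentGap (h : IsOneSidedDeriv S σ g a) (s : ℝ) :
    Continuous (tangentGap g a σ s) := by
  have hg := h.continuous
  refine Continuous.if (fun x hx => ?_) (by fun_prop) continuous_const
  have hmem : σ * (x - s) = 0 := frontier_lt_subset_eq (f := fun x => σ * (x - s)) (by fun_prop)
    continuous_const hx
  rw [sub_eq_zero.1 ((mul_eq_zero.1 hmem).resolve_left h.sign_ne_zero)]
  simp

theorem hasDerivAt_tangentGap (hσ : σ ≠ 0) (hxs : x ≠ s) (hx : HasDerivAt g (a x) x) :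
    HasDerivAt (tangentGap g a σ s) (tangentGapDeriv a σ s x) x := by
  have htangent : HasDerivAt (fun y => g s + a s * (y - s) - g y) (a s - a x) x :=
    (((((hasDerivAt_id x).sub_const s).const_mul (a s)).const_add (g s)).fun_sub hx).congr_deriv
      (by rw [mul_one])
  have hiff := eventually_mul_sub_neg_iff hσ hxs
  by_cases hside : σ * (x - s) < 0
  · rw [tangentGapDeriv, if_pos hside]
    exact htangent.congr_of_eventuallyEq (hiff.mono fun y hy => if_pos (hy.2 hside))
  · rw [tangentGapDeriv, if_neg hside]
    exact (hasDerivAt_const x (0 : ℝ)).congr_of_eventuallyEq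
      (hiff.mono fun y hy => if_neg (mt hy.1 hside))

theorem continuousAt_tangentGapDeriv (hσ : σ ≠ 0) (hxs : x ≠ s) (hx : ContinuousAt a x) :
    ContinuousAt (tangentGapDeriv a σ s) x := by
  have hiff := eventually_mul_sub_neg_iff hσ hxs
  by_cases hside : σ * (x - s) < 0
  · exact (continuousAt_const.sub hx).congr (hiff.mono fun y hy => (if_pos (hy.2 hside)).symm)
  · exact continuousAt_const.congr (hiff.mono fun y hy => (if_neg (mt hy.1 hside)).symm)

theorem IsOneSidedDeriv.continuousAt_add_tangentGapDeriv (h : IsOneSidedDeriv S σ g a) (s : ℝ) :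
    ContinuousAt (fun x => a x + tangentGapDeriv a σ s x) s := by
  have hself : a s + tangentGapDeriv a σ s s = a s := by simp [tangentGapDeriv]
  rw [continuousAt_iff_punctured_nhds, hself]
  have hcover : 𝓝[≠] s ≤ 𝓝[{y | 0 < σ * (y - s)}] s ⊔ 𝓝[{y | σ * (y - s) < 0}] s := by
    rw [← nhdsWithin_union]
    refine nhdsWithin_mono s fun y hy => ?_
    exact (lt_or_gt_of_ne (mul_ne_zero h.sign_ne_zero (sub_ne_zero.2 hy))).symm
  refine Tendsto.mono_left (tendsto_sup.2 ⟨?_, ?_⟩) hcover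
  · refine (h.continuousWithinAt s).congr' (eventually_mem_nhdsWithin.mono fun y hy => ?_)
    simp only [tangentGapDeriv, if_neg (show 0 < σ * (y - s) from hy).not_gt, add_zero]
  · refine tendsto_const_nhds.congr' (eventually_mem_nhdsWithin.mono fun y hy => ?_)
    simp only [tangentGapDeriv, if_pos (show σ * (y - s) < 0 from hy), add_sub_cancel]

theorem abs_tangentGapDeriv_le {C : ℝ} (hs : |a s| ≤ C) (hx : |a x| ≤ C) :
    |tangentGapDeriv a σ s x| ≤ 2 * C := by
  unfold tangentGapDeriv
  split_ifs
  · exact (abs_sub _ _).trans (by linarith)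
  · simpa using (abs_nonneg _).trans hs

theorem IsOneSidedDeriv.abs_tangentGap_le (h : IsOneSidedDeriv S σ g a) {C : ℝ}
    (hC : ∀ t ∈ Set.uIcc s x, |a t| ≤ C) : |tangentGap g a σ s x| ≤ 2 * C * |x - s| := by
  have hs : |a s| ≤ C := hC s Set.left_mem_uIcc
  unfold tangentGap
  split_ifs
  · have htangent : |a s * (x - s)| ≤ C * |x - s| := by
      rw [abs_mul]
      exact mul_le_mul_of_nonneg_right hs (abs_nonneg _)
    have hincr : |g x - g s| ≤ C * |x - s| :=
      abs_sub_le_mul_of_hasDerivAt_off_countable S.countable_toSet h.continuous h.hasDerivAt hC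
    rw [show g s + a s * (x - s) - g x = a s * (x - s) - (g x - g s) by ring]
    exact (abs_sub _ _).trans (by linarith)
  · have := (abs_nonneg _).trans hs
    simpa using by positivity

end TangentGap

/-- A smooth cutoff function, equal to `1` on `[-1/2, 1/2]` and supported in `[-1, 1]`. -/
def cutoff : ContDiffBump (0 : ℝ) := ⟨1 / 2, 1, by norm_num, by norm_num⟩

theorem continuous_deriv_cutoff : Continuous (deriv cutoff) :=
  (cutoff.contDiff (n := 1)).continuous_deriv le_rfl

theorem hasDerivAt_cutoff_div (s ε x : ℝ) :
    HasDerivAt (fun y => cutoff ((y - s) / ε)) (deriv cutoff ((x - s) / ε) / ε) x := by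
  have hcut : HasDerivAt cutoff (deriv cutoff ((x - s) / ε)) ((x - s) / ε) :=
    ((cutoff.contDiff (n := 1)).differentiable one_ne_zero _).hasDerivAt
  exact (hcut.comp x (((hasDerivAt_id x).sub_const s).div_const ε)).congr_deriv
    (by rw [mul_one_div])

theorem cutoff_div_eq_zero {ε y : ℝ} (hε : 0 < ε) (hy : ε < |y|) :
    cutoff (y / ε) = 0 ∧ deriv cutoff (y / ε) = 0 := by
  have hzero : cutoff =ᶠ[𝓝 (y / ε)] 0 := by
    rw [← notMem_tsupport_iff_eventuallyEq, cutoff.tsupport_eq, mem_closedBall_zero_iff,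
      Real.norm_eq_abs, abs_div, abs_of_pos hε, not_le]
    exact (one_lt_div hε).2 hy
  exact ⟨hzero.eq_of_nhds, by simpa using hzero.deriv_eq⟩

/-- The function `g` with every kink `s ∈ S` replaced, on the side opposite to the sign of `σ` and
on the scale `ε`, by the tangent line at `s`. -/
def smoothing (S : Finset ℝ) (σ : ℝ) (g a : ℝ → ℝ) (ε x : ℝ) : ℝ :=
  g x + ∑ s ∈ S, cutoff ((x - s) / ε) * tangentGap g a σ s x

/-- The derivative of `smoothing`. -/
def smoothingDeriv (S : Finset ℝ) (σ : ℝ) (g a : ℝ → ℝ) (ε x : ℝ) : ℝ :=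
  a x + ∑ s ∈ S, (deriv cutoff ((x - s) / ε) / ε * tangentGap g a σ s x +
    cutoff ((x - s) / ε) * tangentGapDeriv a σ s x)

section Smoothing

variable {S : Finset ℝ} {g a : ℝ → ℝ} {σ ε x : ℝ}

theorem smoothing_eq_of_forall_lt_abs_sub (hε : 0 < ε) (hx : ∀ s ∈ S, x ≠ s → ε < |x - s|) :
    smoothing S σ g a ε x = g x ∧ smoothingDeriv S σ g a ε x = a x := by
  unfold smoothing smoothingDeriv
  refine ⟨add_eq_left.2 (Finset.sum_eq_zero fun s hs => ?_),
    add_eq_left.2 (Finset.sum_eq_zero fun s hs => ?_)⟩ <;>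
  · rcases eq_or_ne x s with rfl | hxs
    · simp [tangentGap, tangentGapDeriv]
    · simp [cutoff_div_eq_zero hε (hx s hs hxs)]

theorem IsOneSidedDeriv.continuous_smoothing (h : IsOneSidedDeriv S σ g a) (ε : ℝ) :
    Continuous (smoothing S σ g a ε) :=
  h.continuous.add <| continuous_finsetSum _ fun s _ =>
    (cutoff.continuous.comp (by fun_prop)).mul (h.continuous_tangentGap s)

theorem IsOneSidedDeriv.hasDerivAt_smoothing_of_notMem (h : IsOneSidedDeriv S σ g a) (ε : ℝ)
    (hx : x ∉ S) : HasDerivAt (smoothing S σ g a ε) (smoothingDeriv S σ g a ε x) x :=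
  (h.hasDerivAt x hx).add <| HasDerivAt.fun_sum fun s hs => (hasDerivAt_cutoff_div s ε x).mul <|
    hasDerivAt_tangentGap h.sign_ne_zero (fun hxs => hx (hxs ▸ hs)) (h.hasDerivAt x hx)

theorem IsOneSidedDeriv.continuousAt_add_sum_tangentGapDeriv (h : IsOneSidedDeriv S σ g a)
    (hε : 0 < ε) (hsep : ∀ s ∈ S, ∀ t ∈ S, s ≠ t → ε < |s - t|) (x : ℝ) :
    ContinuousAt (fun y => a y + ∑ s ∈ S, cutoff ((y - s) / ε) * tangentGapDeriv a σ s y) x := by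
  have hcut : ∀ s, Continuous fun y => cutoff ((y - s) / ε) := fun s =>
    cutoff.continuous.comp (by fun_prop)
  by_cases hx : x ∈ S
  · have hone : ∀ᶠ y in 𝓝 x, cutoff ((y - x) / ε) = 1 := by
      have hlim : Tendsto (fun y => (y - x) / ε) (𝓝 x) (𝓝 0) := by
        have hc : Continuous fun y => (y - x) / ε := by fun_prop
        simpa using hc.tendsto x
      exact hlim.eventually cutoff.eventuallyEq_one
    have hzero : ∀ᶠ y in 𝓝 x, ∀ s ∈ S, x ≠ s → ε < |y - s| := by
      simp only [Filter.eventually_all_finset, Filter.eventually_imp_distrib_left]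
      exact fun s hs hxs => (show ContinuousAt (fun y => |y - s|) x by fun_prop).eventually
        (lt_mem_nhds (hsep x hx s hs hxs))
    refine (h.continuousAt_add_tangentGapDeriv x).congr ?_
    filter_upwards [hone, hzero] with y hy1 hy0
    rw [Finset.sum_eq_single_of_mem x hx fun s hs hsx => by
      rw [(cutoff_div_eq_zero hε (hy0 s hs hsx.symm)).1, zero_mul], hy1, one_mul]
  · refine (h.continuousAt x hx).add (tendsto_finsetSum _ fun s hs => ?_)
    exact (hcut s).continuousAt.mul <| continuousAt_tangentGapDeriv h.sign_ne_zero
      (fun hxs => hx (hxs ▸ hs)) (h.continuousAt x hx)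

theorem IsOneSidedDeriv.continuous_smoothingDeriv (h : IsOneSidedDeriv S σ g a) (hε : 0 < ε)
    (hsep : ∀ s ∈ S, ∀ t ∈ S, s ≠ t → ε < |s - t|) : Continuous (smoothingDeriv S σ g a ε) := by
  have hgap : Continuous fun x =>
      ∑ s ∈ S, deriv cutoff ((x - s) / ε) / ε * tangentGap g a σ s x :=
    continuous_finsetSum _ fun s _ => ((continuous_deriv_cutoff.comp (by fun_prop)).div_const
      _).mul (h.continuous_tangentGap s)
  refine (hgap.add (continuous_iff_continuousAt.2
    (h.continuousAt_add_sum_tangentGapDeriv hε hsep))).congr fun x => ?_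
  simp only [smoothingDeriv, Finset.sum_add_distrib, Pi.add_apply]
  ring

theorem IsOneSidedDeriv.hasDerivAt_smoothing (h : IsOneSidedDeriv S σ g a) (hε : 0 < ε)
    (hsep : ∀ s ∈ S, ∀ t ∈ S, s ≠ t → ε < |s - t|) (x : ℝ) :
    HasDerivAt (smoothing S σ g a ε) (smoothingDeriv S σ g a ε x) x :=
  hasDerivAt_of_forall_notMem_countable S.countable_toSet (h.continuous_smoothing ε)
    (h.continuous_smoothingDeriv hε hsep) (fun _ hy => h.hasDerivAt_smoothing_of_notMem ε hy) x

theorem exists_abs_deriv_cutoff_mul_le : ∃ K, ∀ u : ℝ, |deriv cutoff u * u| ≤ K :=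
  (cutoff.hasCompactSupport.deriv.mul_right).exists_bound_of_continuous
    (continuous_deriv_cutoff.mul continuous_id)

theorem abs_cutoff_mul_le (u y : ℝ) : |cutoff u * y| ≤ |y| := by
  rw [abs_mul, abs_of_nonneg cutoff.nonneg]
  exact mul_le_of_le_one_left (abs_nonneg y) cutoff.le_one

theorem IsOneSidedDeriv.exists_bound_smoothing (h : IsOneSidedDeriv S σ g a) {b : ℝ → ℝ}
    (hb : HasLocalBound b a) (r : ℝ) : ∃ C, ∀ ε x, |x| ≤ r →
      |smoothing S σ g a ε x| + |smoothingDeriv S σ g a ε x| ≤ C := by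
  obtain ⟨K, hK⟩ := exists_abs_deriv_cutoff_mul_le
  obtain ⟨B, hB⟩ := exists_norm_le_of_continuous h.continuous r
  obtain ⟨R, hrR, hSR⟩ : ∃ R, r ≤ R ∧ ∀ s ∈ S, |s| ≤ R := by
    obtain ⟨M, hM⟩ := (S.image abs).bddAbove
    exact ⟨max r M, le_max_left _ _, fun s hs =>
      le_max_of_le_right (hM (Finset.mem_coe.2 (Finset.mem_image_of_mem _ hs)))⟩
  refine ⟨B + ∑ s ∈ S, 2 * b R * (R + R) + (b R + ∑ s ∈ S, (2 * b R * K + 2 * b R)),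
    fun ε x hx => ?_⟩
  have hxR : |x| ≤ R := hx.trans hrR
  have hbR : 0 ≤ b R := (abs_nonneg _).trans (hb R x hxR)
  have hgap : ∀ s ∈ S, |tangentGap g a σ s x| ≤ 2 * b R * |x - s| := fun s hs =>
    h.abs_tangentGap_le fun t ht => hb R t <| abs_le.2 <|
      Set.uIcc_subset_Icc (abs_le.1 (hSR s hs)) (abs_le.1 hxR) ht
  refine add_le_add ((abs_add_le _ _).trans (add_le_add (hB x hx) ?_))
    ((abs_add_le _ _).trans (add_le_add (hb R x hxR) ?_)) <;>
  refine (Finset.abs_sum_le_sum_abs _ _).trans (Finset.sum_le_sum fun s hs => ?_)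
  · refine (abs_cutoff_mul_le _ _).trans ((hgap s hs).trans ?_)
    exact mul_le_mul_of_nonneg_left ((abs_sub _ _).trans (add_le_add hxR (hSR s hs)))
      (by positivity)
  · refine (abs_add_le _ _).trans (add_le_add ?_ ((abs_cutoff_mul_le _ _).trans
      (abs_tangentGapDeriv_le (hb R s (hSR s hs)) (hb R x hxR))))
    calc |deriv cutoff ((x - s) / ε) / ε * tangentGap g a σ s x|
        ≤ |deriv cutoff ((x - s) / ε) / ε| * (2 * b R * |x - s|) := by
          rw [abs_mul]
          exact mul_le_mul_of_nonneg_left (hgap s hs) (abs_nonneg _)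
      _ = 2 * b R * |deriv cutoff ((x - s) / ε) * ((x - s) / ε)| := by
          simp only [abs_mul, abs_div]
          ring
      _ ≤ 2 * b R * K := mul_le_mul_of_nonneg_left (hK _) (by positivity)

end Smoothing

theorem exists_separation (S : Finset ℝ) : ∃ δ > 0, ∀ s ∈ S, ∀ t ∈ S, s ≠ t → δ < |s - t| := by
  have h : ∀ᶠ δ in 𝓝[>] (0 : ℝ), ∀ s ∈ S, ∀ t ∈ S, s ≠ t → δ < |s - t| := by
    simp only [Filter.eventually_all_finset, Filter.eventually_imp_distrib_left]
    exact fun s _ t _ hst => nhdsWithin_le_nhds (gt_mem_nhds (abs_sub_pos.2 hst))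
  obtain ⟨δ, hδ, hsep⟩ := (eventually_mem_nhdsWithin.and h).exists
  exact ⟨δ, hδ, hsep⟩

theorem IsOneSidedDeriv.exists_isApprox {S : Finset ℝ} {σ w : ℝ} {g a : ℝ → ℝ}
    (h : IsOneSidedDeriv S σ g a) (hw : 0 ≤ w) (hb : w = 0 ∨ ∃ b, HasLocalBound b a) :
    ∃ A : ℕ → ℝ → ℝ, IsApprox g a w A := by
  obtain ⟨δ, hδ, hsep⟩ := exists_separation S
  let ε : ℕ → ℝ := fun n => δ / (n + 1)
  have hε : ∀ n, 0 < ε n := fun n => by positivity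
  have hεsep : ∀ n, ∀ s ∈ S, ∀ t ∈ S, s ≠ t → ε n < |s - t| := fun n s hs t ht hst =>
    (div_le_self hδ.le (by simp)).trans_lt (hsep s hs t ht hst)
  have hderiv : ∀ n x, HasDerivAt (smoothing S σ g a (ε n)) (smoothingDeriv S σ g a (ε n) x) x :=
    fun n => h.hasDerivAt_smoothing (hε n) (hεsep n)
  have hderiv_eq : ∀ n, deriv (smoothing S σ g a (ε n)) = smoothingDeriv S σ g a (ε n) :=
    fun n => funext fun x => (hderiv n x).deriv
  refine ⟨fun n => smoothing S σ g a (ε n), fun n => ?_, fun x => ?_, fun m => ?_⟩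
  · refine contDiff_one_iff_deriv.2 ⟨fun x => (hderiv n x).differentiableAt, ?_⟩
    rw [hderiv_eq]
    exact h.continuous_smoothingDeriv (hε n) (hεsep n)
  · have hlim : Tendsto ε atTop (𝓝 0) := by
      simpa [ε, div_eq_mul_inv] using tendsto_one_div_add_atTop_nhds_zero_nat.const_mul δ
    have hfar : ∀ᶠ n in atTop, ∀ s ∈ S, x ≠ s → ε n < |x - s| := by
      simp only [Filter.eventually_all_finset, Filter.eventually_imp_distrib_left]
      exact fun s _ hxs => hlim.eventually (gt_mem_nhds (abs_sub_pos.2 hxs))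
    obtain ⟨m, hm⟩ := eventually_atTop.1 hfar
    refine ⟨m, ENNReal.tsum_eq_zero.2 fun n => ?_⟩
    obtain ⟨hval, hder⟩ := smoothing_eq_of_forall_lt_abs_sub (g := g) (a := a) (σ := σ)
      (hε (m + n)) (hm (m + n) (Nat.le_add_right m n))
    simp [hderiv_eq, hval, hder]
  · rcases hb with rfl | ⟨b, hb⟩
    · exact ⟨0, by simp⟩
    · obtain ⟨C, hC⟩ := h.exists_bound_smoothing hb m
      refine ⟨C * w, fun n x hx => mul_le_mul_of_nonneg_right ?_ hw⟩
      rw [hderiv_eq]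
      exact hC (ε n) x (abs_le.2 hx)

theorem continuousWithinAt_of_oneSidedOsc_eq_zero {a : ℝ → ℝ} {S : Finset ℝ} {σ : ℝ}
    (hσ : σ * σ = 1) (h : oneSidedOsc a S σ = 0) {s : ℝ} (hs : s ∈ S) :
    ContinuousWithinAt a {y | 0 < σ * (y - s)} s := by
  have hlimsup : limsup (fun h : ℝ => ‖a (s + σ * h) - a s‖ₑ) (𝓝[>] 0) = 0 :=
    Finset.sum_eq_zero_iff.1 h s hs
  have hlim : Tendsto (fun h : ℝ => ‖a (s + σ * h) - a s‖ₑ) (𝓝[>] 0) (𝓝 0) :=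
    tendsto_of_le_liminf_of_limsup_le zero_le hlimsup.le
  have hmap : Tendsto (fun y => σ * (y - s)) (𝓝[{y | 0 < σ * (y - s)}] s) (𝓝[>] 0) := by
    refine tendsto_nhdsWithin_iff.2 ⟨?_, eventually_mem_nhdsWithin⟩
    have hc : Continuous fun y => σ * (y - s) := by fun_prop
    simpa using (hc.tendsto s).mono_left nhdsWithin_le_nhds
  refine tendsto_iff_edist_tendsto_0.2 ((hlim.comp hmap).congr fun y => ?_)
  rw [edist_eq_enorm_sub, Function.comp_apply, ← mul_assoc, hσ, one_mul, add_sub_cancel]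

theorem exists_isOneSidedDeriv {S : Finset ℝ} {g a : ℝ → ℝ} (hg : Continuous g)
    (hgS : ContDiffOn ℝ 1 g (↑S : Set ℝ)ᶜ) (ha : ∀ x ∉ S, a x = deriv g x)
    (hosc : min (oneSidedOsc a S (-1)) (oneSidedOsc a S 1) = 0) :
    ∃ σ, IsOneSidedDeriv S σ g a := by
  obtain ⟨σ, hσ, hσosc⟩ : ∃ σ : ℝ, σ * σ = 1 ∧ oneSidedOsc a S σ = 0 := by
    rcases min_choice (oneSidedOsc a S (-1)) (oneSidedOsc a S 1) with h | h
    · exact ⟨-1, by norm_num, h ▸ hosc⟩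
    · exact ⟨1, by norm_num, h ▸ hosc⟩
  have hopen : IsOpen (↑S : Set ℝ)ᶜ := S.finite_toSet.isClosed.isOpen_compl
  have hcont : ∀ x ∉ S, ContinuousAt a x := fun x hx =>
    ((hgS.continuousOn_deriv_of_isOpen hopen le_rfl).continuousAt (hopen.mem_nhds hx)).congr
      (eventually_of_mem (hopen.mem_nhds hx) fun y hy => (ha y hy).symm)
  refine ⟨σ, left_ne_zero_of_mul_eq_one hσ, hg, fun x hx => ?_, hcont, fun s => ?_⟩
  · rw [ha x hx]
    exact ((hgS.differentiableOn one_ne_zero).differentiableAt (hopen.mem_nhds hx)).hasDerivAt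
  · by_cases hs : s ∈ S
    · exact continuousWithinAt_of_oneSidedOsc_eq_zero hσ hσosc hs
    · exact (hcont s hs).continuousWithinAt

theorem isOneSidedDeriv_deriv {A : ℝ → ℝ} (hA : ContDiff ℝ 1 A) :
    IsOneSidedDeriv ∅ 1 A (deriv A) where
  sign_ne_zero := one_ne_zero
  continuous := hA.continuous
  hasDerivAt x _ := (hA.differentiable one_ne_zero x).hasDerivAt
  continuousAt _ _ := (hA.continuous_deriv le_rfl).continuousAt
  continuousWithinAt _ := (hA.continuous_deriv le_rfl).continuousWithinAt

theorem isApprox_const {A : ℝ → ℝ} (hA : ContDiff ℝ 1 A) :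
    IsApprox A (deriv A) 1 fun _ => A where
  contDiff _ := hA
  eventually_eq x := ⟨0, by simp⟩
  bounded m := by
    have hcont : Continuous fun x => |A x| + |deriv A x| :=
      hA.continuous.abs.add (hA.continuous_deriv le_rfl).abs
    obtain ⟨C, hC⟩ := exists_norm_le_of_continuous hcont m
    refine ⟨C, fun _ x hx => ?_⟩
    rw [mul_one]
    exact (le_abs_self _).trans (hC x (abs_le.2 hx))

section BoundWeight

variable {E : Type*} [TopologicalSpace E] [MeasurableSpace E]

theorem boundWeight_nonneg (z : ℕ) (ν : Measure E) : 0 ≤ boundWeight z ν :=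
  add_nonneg (Nat.cast_nonneg z) (Set.indicator_nonneg (fun _ _ => zero_le_one) _)

theorem boundWeight_pos_of_infinite_support {ν : Measure E} (h : ¬ν.support.Finite) (z : ℕ) :
    0 < boundWeight z ν := by
  have htop : ν.support.encard = ⊤ := Set.encard_eq_top h
  simp only [boundWeight, htop, Set.mem_singleton_iff, Set.indicator_of_mem]
  positivity

end BoundWeight

theorem exists_hasLocalBound_of_mul_le {w : ℝ} (hw : 0 < w) {f : ℝ → ℝ}
    (h : ∀ m : ℕ, ∃ C : ℝ, ∀ x ∈ Set.Icc (-(m : ℝ)) m, |f x| * w ≤ C) :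
    ∃ b, HasLocalBound b f := by
  choose C hC using h
  exact ⟨fun r => C ⌈r⌉₊ / w, fun r x hx => (le_div_iff₀ hw).2 <|
    hC _ x (abs_le.1 (hx.trans (Nat.le_ceil r)))⟩

theorem IsApprox.eventually {g a : ℝ → ℝ} {w : ℝ} {A : ℕ → ℝ → ℝ} (h : IsApprox g a w A) (x : ℝ) :
    ∀ᶠ n in atTop, A n x = g x ∧ deriv (A n) x = a x := by
  obtain ⟨m, hm⟩ := h.eventually_eq x
  refine eventually_atTop.2 ⟨m, fun n hn => ?_⟩
  have hzero := ENNReal.tsum_eq_zero.1 hm (n - m)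
  rw [Nat.add_sub_cancel' hn, add_eq_zero, enorm_eq_zero, enorm_eq_zero, sub_eq_zero,
    sub_eq_zero] at hzero
  exact ⟨hzero.1.symm, hzero.2.symm⟩

theorem IsApprox.exists_hasLocalBound {g a : ℝ → ℝ} {w : ℝ} {A : ℕ → ℝ → ℝ}
    (h : IsApprox g a w A) (hw : 0 < w) : ∃ b,
      (∀ n, HasLocalBound b (A n) ∧ HasLocalBound b (deriv (A n))) ∧
      HasLocalBound b g ∧ HasLocalBound b a := by
  choose C hC using h.bounded
  have hAn : ∀ n, HasLocalBound (fun r => C ⌈r⌉₊ / w) (A n) ∧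
      HasLocalBound (fun r => C ⌈r⌉₊ / w) (deriv (A n)) := fun n => by
    have hsum : ∀ r x : ℝ, |x| ≤ r → |A n x| + |deriv (A n) x| ≤ C ⌈r⌉₊ / w := fun r x hx =>
      (le_div_iff₀ hw).2 (hC _ n x (abs_le.1 (hx.trans (Nat.le_ceil r))))
    exact ⟨fun r x hx => le_of_add_le_of_nonneg_left (hsum r x hx) (abs_nonneg _),
      fun r x hx => le_of_add_le_of_nonneg_right (hsum r x hx) (abs_nonneg _)⟩
  refine ⟨_, hAn, fun r x hx => ?_, fun r x hx => ?_⟩ <;> obtain ⟨n, hn⟩ := (h.eventually x).exists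
  · exact hn.1 ▸ (hAn n).1 r x hx
  · exact hn.2 ▸ (hAn n).2 r x hx

section Network

variable {ℓ : ℕ → ℕ} {d : ℕ}

theorem contDiff_entry (n : ℕ) : ContDiff ℝ 1 fun θ : EuclideanSpace ℝ (Fin d) => entry θ n := by
  unfold entry
  split_ifs <;> fun_prop

/-- The affine part of layer `k + 1`: its value before activation as a function of the parameters
`q.1` and of the activated values `q.2` of layer `k`. -/
def affineLayer (ℓ : ℕ → ℕ) {d : ℕ} (k : ℕ)
    (q : EuclideanSpace ℝ (Fin d) × (Fin (ℓ k) → ℝ)) : Layer ℓ (k + 1) :=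
  WithLp.toLp 2 fun i =>
    entry q.1 (biasIdx ℓ k i) + ∑ j : Fin (ℓ k), entry q.1 (weightIdx ℓ k i j) * q.2 j

/-- The values that layer `k` passes on: the input itself for `k = 0`, the entrywise activation of
the layer for `k ≥ 1`. -/
def activate (A : ℝ → ℝ) (k : ℕ) (u : Layer ℓ k) : Fin (ℓ k) → ℝ :=
  fun j => if k = 0 then u j else A (u j)

theorem realization_succ (A : ℝ → ℝ) (θ : EuclideanSpace ℝ (Fin d)) (x : Layer ℓ 0) (k : ℕ) :
    realization ℓ A θ x (k + 1) = affineLayer ℓ k (θ, activate A k (realization ℓ A θ x k)) :=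
  rfl

theorem contDiff_affineLayer (k : ℕ) :
    ContDiff ℝ 1 (affineLayer ℓ k : EuclideanSpace ℝ (Fin d) × (Fin (ℓ k) → ℝ) → _) := by
  have hentry := contDiff_entry (d := d)
  unfold affineLayer
  fun_prop

theorem continuous_activate {A : ℝ → ℝ} (hA : Continuous A) (k : ℕ) :
    Continuous (activate (ℓ := ℓ) A k) := by
  unfold activate
  split_ifs <;> fun_prop

theorem continuous_realization {A : ℝ → ℝ} (hA : Continuous A) (k : ℕ) :
    Continuous fun q : EuclideanSpace ℝ (Fin d) × Layer ℓ 0 => realization ℓ A q.1 q.2 k := by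
  induction k with
  | zero => exact continuous_snd
  | succ k ih =>
    exact (contDiff_affineLayer k).continuous.comp
      (continuous_fst.prodMk ((continuous_activate hA k).comp ih))

/-- The chain rule for layer `k + 1`: the derivative of its value with respect to the parameters at
`q = (θ, ξ, c, D)`, where `ξ` are the activated values of layer `k`, `c` the derivatives of the
activation there, and `D` is the derivative of the value of layer `k`. -/
def affineLayerDeriv (ℓ : ℕ → ℕ) {d : ℕ} (k : ℕ)
    (q : EuclideanSpace ℝ (Fin d) × (Fin (ℓ k) → ℝ) × (Fin (ℓ k) → ℝ) ×
      (EuclideanSpace ℝ (Fin d) →L[ℝ] Layer ℓ k)) :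
    EuclideanSpace ℝ (Fin d) →L[ℝ] Layer ℓ (k + 1) :=
  fderiv ℝ (affineLayer ℓ k) (q.1, q.2.1) ∘L
    (ContinuousLinearMap.id ℝ _).prod
      (ContinuousLinearMap.pi fun j => q.2.2.1 j • (EuclideanSpace.proj j ∘L q.2.2.2))

theorem continuous_affineLayerDeriv (k : ℕ) : Continuous (affineLayerDeriv ℓ (d := d) k) := by
  have hderiv := (contDiff_affineLayer (ℓ := ℓ) (d := d) k).continuous_fderiv one_ne_zero
  have hprod := (ContinuousLinearMap.prodₗᵢ (𝕜 := ℝ) (E := EuclideanSpace ℝ (Fin d))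
    (F := EuclideanSpace ℝ (Fin d)) (G := Fin (ℓ k) → ℝ) ℝ).continuous
  have hpi := (ContinuousLinearMap.piEquivL ℝ (EuclideanSpace ℝ (Fin d))
    fun _ : Fin (ℓ k) => ℝ).continuous
  refine (hderiv.comp (by fun_prop)).clm_comp
    (hprod.comp (continuous_const.prodMk (hpi.comp (continuous_pi fun j => ?_))))
  fun_prop

/-- The formal derivative with respect to the parameters of the realization, computed by the chain
rule with the function `a` in place of the derivative of the activation `A`. -/
def dRealization (ℓ : ℕ → ℕ) {d : ℕ} (A a : ℝ → ℝ) (θ : EuclideanSpace ℝ (Fin d))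
    (x : Layer ℓ 0) : (k : ℕ) → EuclideanSpace ℝ (Fin d) →L[ℝ] Layer ℓ k
  | 0 => 0
  | k + 1 => affineLayerDeriv ℓ k (θ, activate A k (realization ℓ A θ x k),
      fun j => a (realization ℓ A θ x k j), dRealization ℓ A a θ x k)

theorem hasFDerivAt_realization {A a : ℝ → ℝ} {θ : EuclideanSpace ℝ (Fin d)} {x : Layer ℓ 0}
    (k : ℕ) (h : ∀ m < k, m ≠ 0 → ∀ j,
      HasDerivAt A (a (realization ℓ A θ x m j)) (realization ℓ A θ x m j)) :
    HasFDerivAt (fun θ' => realization ℓ A θ' x k) (dRealization ℓ A a θ x k) θ := by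
  induction k with
  | zero => exact hasFDerivAt_const x θ
  | succ k ih =>
    have ih := ih fun m hm => h m (hm.trans k.lt_succ_self)
    have hact : HasFDerivAt (fun θ' => activate A k (realization ℓ A θ' x k))
        (ContinuousLinearMap.pi fun j => a (realization ℓ A θ x k j) •
          (EuclideanSpace.proj j ∘L dRealization ℓ A a θ x k)) θ := by
      refine hasFDerivAt_pi.2 fun j => ?_
      have ihj : HasFDerivAt (fun θ' => realization ℓ A θ' x k j)
          (EuclideanSpace.proj j ∘L dRealization ℓ A a θ x k) θ :=
        (EuclideanSpace.proj j : Layer ℓ k →L[ℝ] ℝ).hasFDerivAt.comp θ ih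
      rcases k with _ | k
      · simpa [activate, dRealization] using ihj
      · exact (h _ (Nat.lt_succ_self _) k.succ_ne_zero j).comp_hasFDerivAt θ ihj
    exact (((contDiff_affineLayer k).differentiable one_ne_zero _).hasFDerivAt).comp θ
      ((hasFDerivAt_id θ).prodMk hact)

theorem tendsto_dRealization {ι : Type*} {l : Filter ι} {A a : ℝ → ℝ} (hA : Continuous A)
    {q : ι → EuclideanSpace ℝ (Fin d) × Layer ℓ 0} {q₀ : EuclideanSpace ℝ (Fin d) × Layer ℓ 0}
    (hq : Tendsto q l (𝓝 q₀)) (k : ℕ)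
    (ha : ∀ m < k, ∀ j, Tendsto (fun n => a (realization ℓ A (q n).1 (q n).2 m j)) l
      (𝓝 (a (realization ℓ A q₀.1 q₀.2 m j)))) :
    Tendsto (fun n => dRealization ℓ A a (q n).1 (q n).2 k) l
      (𝓝 (dRealization ℓ A a q₀.1 q₀.2 k)) := by
  induction k with
  | zero => exact tendsto_const_nhds
  | succ k ih =>
    have hact :=
      (((continuous_activate hA k).comp (continuous_realization hA k)).tendsto q₀).comp hq
    have hfst := (continuous_fst.tendsto q₀).comp hq
    exact ((continuous_affineLayerDeriv k).tendsto _).comp <| hfst.prodMk_nhds <|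
      hact.prodMk_nhds <| (tendsto_pi_nhds.2 (ha k k.lt_succ_self)).prodMk_nhds <|
      ih fun m hm => ha m (hm.trans k.lt_succ_self)

theorem activate_congr {A B : ℝ → ℝ} (k : ℕ) {u : Layer ℓ k} (h : ∀ j, A (u j) = B (u j)) :
    activate A k u = activate B k u := by
  ext j
  simp only [activate, h j]

theorem realization_congr {A B : ℝ → ℝ} {θ : EuclideanSpace ℝ (Fin d)} {x : Layer ℓ 0}
    (k : ℕ) (h : ∀ m < k, ∀ j, A (realization ℓ A θ x m j) = B (realization ℓ A θ x m j)) :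
    realization ℓ A θ x k = realization ℓ B θ x k := by
  induction k with
  | zero => rfl
  | succ k ih =>
    have ih := ih fun m hm => h m (hm.trans k.lt_succ_self)
    rw [realization_succ, realization_succ, activate_congr k (h k k.lt_succ_self), ih]

theorem dRealization_congr {A B a b : ℝ → ℝ} {θ : EuclideanSpace ℝ (Fin d)} {x : Layer ℓ 0}
    (k : ℕ) (hA : ∀ m < k, ∀ j, A (realization ℓ A θ x m j) = B (realization ℓ A θ x m j))
    (ha : ∀ m < k, ∀ j, a (realization ℓ A θ x m j) = b (realization ℓ A θ x m j)) :
    dRealization ℓ A a θ x k = dRealization ℓ B b θ x k := by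
  induction k with
  | zero => rfl
  | succ k ih =>
    have ih := ih (fun m hm => hA m (hm.trans k.lt_succ_self))
      fun m hm => ha m (hm.trans k.lt_succ_self)
    have hN := realization_congr k fun m hm => hA m (hm.trans k.lt_succ_self)
    simp only [dRealization, ← hN, ih, ha k k.lt_succ_self,
      activate_congr k (hA k k.lt_succ_self)]

theorem exists_bound_realization (b : ℝ → ℝ) (r : ℝ) (k : ℕ) :
    ∃ C : ℝ, ∀ A a : ℝ → ℝ, HasLocalBound b A → HasLocalBound b a →
      ∀ (θ : EuclideanSpace ℝ (Fin d)) (x : Layer ℓ 0), ‖θ‖ ≤ r → ‖x‖ ≤ r →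
        ‖realization ℓ A θ x k‖ ≤ C ∧ ‖dRealization ℓ A a θ x k‖ ≤ C := by
  induction k with
  | zero =>
    refine ⟨r, fun A a _ _ θ x _ hx => ⟨hx, ?_⟩⟩
    simpa [dRealization] using (norm_nonneg x).trans hx
  | succ k ih =>
    obtain ⟨C, hC⟩ := ih
    have hcont : Continuous fun q : EuclideanSpace ℝ (Fin d) × (Fin (ℓ k) → ℝ) ×
        (Fin (ℓ k) → ℝ) × (EuclideanSpace ℝ (Fin d) →L[ℝ] Layer ℓ k) =>
        (affineLayer ℓ k (q.1, q.2.1), affineLayerDeriv ℓ k q) :=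
      ((contDiff_affineLayer k).continuous.comp (by fun_prop)).prodMk
        (continuous_affineLayerDeriv k)
    obtain ⟨B, hB⟩ := exists_norm_le_of_continuous hcont (max r (max C (b C)))
    refine ⟨B, fun A a hA ha θ x hθ hx => ?_⟩
    obtain ⟨hN, hD⟩ := hC A a hA ha θ x hθ hx
    have hC0 : 0 ≤ C := (norm_nonneg _).trans hN
    have hNj := fun j => (PiLp.norm_apply_le (realization ℓ A θ x k) j).trans hN
    have hact : ‖activate A k (realization ℓ A θ x k)‖ ≤ max C (b C) := by
      refine (pi_norm_le_iff_of_nonneg (le_max_of_le_left hC0)).2 fun j => ?_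
      unfold activate
      split_ifs
      · exact le_max_of_le_left (hNj j)
      · exact le_max_of_le_right (hA C _ (hNj j))
    have hder : ‖fun j => a (realization ℓ A θ x k j)‖ ≤ max C (b C) :=
      (pi_norm_le_iff_of_nonneg (le_max_of_le_left hC0)).2 fun j =>
        le_max_of_le_right (ha C _ (hNj j))
    exact norm_prod_le_iff.1 <| hB (θ, activate A k (realization ℓ A θ x k), _,
      dRealization ℓ A a θ x k) <| norm_prod_le_iff.2 ⟨le_max_of_le_left hθ,
      norm_prod_le_iff.2 ⟨le_max_of_le_right hact, norm_prod_le_iff.2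
        ⟨le_max_of_le_right hder, le_max_of_le_right (le_max_of_le_left hD)⟩⟩⟩

end Network

theorem norm_fderiv_apply_le_norm_gradient {E F G : Type*} [NormedAddCommGroup E]
    [InnerProductSpace ℝ E] [CompleteSpace E] [NormedAddCommGroup F] [NormedSpace ℝ F]
    [NormedAddCommGroup G] [InnerProductSpace ℝ G] [CompleteSpace G] {f : E × F × G → ℝ} {x : E}
    {y : F} {z : G} (hf : DifferentiableAt ℝ f (x, y, z)) (u : E) (v : G) :
    ‖fderiv ℝ f (x, y, z) (u, 0, v)‖ ≤
      ‖∇ (fun x' => f (x', y, z)) x‖ * ‖u‖ + ‖∇ (fun z' => f (x, y, z')) z‖ * ‖v‖ := by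
  have hx : fderiv ℝ (fun x' => f (x', y, z)) x u = fderiv ℝ f (x, y, z) (u, 0, 0) := by
    have hx' : HasFDerivAt (fun x' => f (x', y, z))
        (fderiv ℝ f (x, y, z) ∘L (ContinuousLinearMap.id ℝ E).prod 0) x :=
      hf.hasFDerivAt.comp (g := f) x ((hasFDerivAt_id x).prodMk (hasFDerivAt_const (y, z) x))
    rw [hx'.fderiv]
    rfl
  have hz : fderiv ℝ (fun z' => f (x, y, z')) z v = fderiv ℝ f (x, y, z) (0, 0, v) := by
    have hz' : HasFDerivAt (fun z' => f (x, y, z')) (fderiv ℝ f (x, y, z) ∘L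
        (0 : G →L[ℝ] E).prod ((0 : G →L[ℝ] F).prod (ContinuousLinearMap.id ℝ G))) z :=
      hf.hasFDerivAt.comp (g := f) z ((hasFDerivAt_const x z).prodMk
        ((hasFDerivAt_const y z).prodMk (hasFDerivAt_id z)))
    rw [hz'.fderiv]
    rfl
  have hsplit : ((u, 0, v) : E × F × G) = (u, 0, 0) + (0, 0, v) := by simp
  rw [hsplit, map_add, ← hx, ← hz, gradient, gradient, LinearIsometryEquiv.norm_map,
    LinearIsometryEquiv.norm_map]
  exact (norm_add_le _ _).trans (add_le_add (ContinuousLinearMap.le_opNorm _ _)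
    (ContinuousLinearMap.le_opNorm _ _))

section Loss

variable {ℓ : ℕ → ℕ} {L : ℕ} {H : Layer ℓ L × Layer ℓ L × Param ℓ L → ℝ}
  {μ : Measure (Layer ℓ 0 × Layer ℓ L)} {A a : ℝ → ℝ} {θ : Param ℓ L}
  {p : Layer ℓ 0 × Layer ℓ L}

/-- The formal derivative of the loss with respect to the parameters, computed by the chain rule
with the function `a` in place of the derivative of the activation `A`. -/
def dLoss (ℓ : ℕ → ℕ) (L : ℕ) (H : Layer ℓ L × Layer ℓ L × Param ℓ L → ℝ) (A a : ℝ → ℝ)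
    (θ : Param ℓ L) (p : Layer ℓ 0 × Layer ℓ L) : Param ℓ L →L[ℝ] ℝ :=
  fderiv ℝ H (realization ℓ A θ p.1 L, p.2, θ) ∘L
    (dRealization ℓ A a θ p.1 L).prod ((0 : Param ℓ L →L[ℝ] Layer ℓ L).prod (.id ℝ _))

theorem hasFDerivAt_lossAt (hH : ContDiff ℝ 1 H) (h : ∀ k < L, k ≠ 0 → ∀ j,
      HasDerivAt A (a (realization ℓ A θ p.1 k j)) (realization ℓ A θ p.1 k j)) :
    HasFDerivAt (fun θ' => lossAt ℓ L H A θ' p) (dLoss ℓ L H A a θ p) θ :=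
  (hH.differentiable one_ne_zero _).hasFDerivAt.comp θ
    ((hasFDerivAt_realization L h).prodMk ((hasFDerivAt_const p.2 θ).prodMk (hasFDerivAt_id θ)))

theorem tendsto_dLoss (hH : ContDiff ℝ 1 H) (hA : Continuous A) {ι : Type*} {l : Filter ι}
    {q : ι → Param ℓ L × Layer ℓ 0 × Layer ℓ L} {q₀ : Param ℓ L × Layer ℓ 0 × Layer ℓ L}
    (hq : Tendsto q l (𝓝 q₀)) (ha : ∀ m < L, ∀ j,
      Tendsto (fun n => a (realization ℓ A (q n).1 (q n).2.1 m j)) l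
        (𝓝 (a (realization ℓ A q₀.1 q₀.2.1 m j)))) :
    Tendsto (fun n => dLoss ℓ L H A a (q n).1 (q n).2) l (𝓝 (dLoss ℓ L H A a q₀.1 q₀.2)) := by
  have hθx : Tendsto (fun n => ((q n).1, (q n).2.1)) l (𝓝 (q₀.1, q₀.2.1)) :=
    ((by fun_prop : Continuous fun q : Param ℓ L × Layer ℓ 0 × Layer ℓ L =>
      (q.1, q.2.1)).tendsto q₀).comp hq
  have hyθ : Tendsto (fun n => ((q n).2.2, (q n).1)) l (𝓝 (q₀.2.2, q₀.1)) :=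
    ((by fun_prop : Continuous fun q : Param ℓ L × Layer ℓ 0 × Layer ℓ L =>
      (q.2.2, q.1)).tendsto q₀).comp hq
  have hN := ((continuous_realization hA L).tendsto _).comp hθx
  have hprod := (ContinuousLinearMap.prodₗᵢ (𝕜 := ℝ) (E := Param ℓ L) (F := Layer ℓ L)
    (G := Layer ℓ L × Param ℓ L) ℝ).continuous
  have hcomp := (ContinuousLinearMap.compL ℝ (Param ℓ L)
    (Layer ℓ L × Layer ℓ L × Param ℓ L) ℝ).continuous₂
  exact (hcomp.tendsto _).comp <|
    (((hH.continuous_fderiv one_ne_zero).tendsto _).comp (hN.prodMk_nhds hyθ)).prodMk_nhds <|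
    (hprod.tendsto _).comp ((tendsto_dRealization hA hθx L ha).prodMk_nhds tendsto_const_nhds)

theorem continuous_dLoss (hH : ContDiff ℝ 1 H) (hA : Continuous A) (ha : Continuous a)
    (θ : Param ℓ L) : Continuous (dLoss ℓ L H A a θ) := by
  refine continuous_iff_continuousAt.2 fun p => tendsto_dLoss hH hA
    (tendsto_const_nhds.prodMk_nhds tendsto_id) fun m _ j => ?_
  exact ((ha.comp ((EuclideanSpace.proj j).continuous.comp ((continuous_realization hA m).comp
    (by fun_prop : Continuous fun p : Layer ℓ 0 × Layer ℓ L => (θ, p.1))))).tendsto p)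

theorem dLoss_congr {B b : ℝ → ℝ}
    (hA : ∀ m < L, ∀ j, A (realization ℓ A θ p.1 m j) = B (realization ℓ A θ p.1 m j))
    (ha : ∀ m < L, ∀ j, a (realization ℓ A θ p.1 m j) = b (realization ℓ A θ p.1 m j)) :
    dLoss ℓ L H A a θ p = dLoss ℓ L H B b θ p := by
  simp only [dLoss, dRealization_congr L hA ha, realization_congr L hA]

theorem continuous_lossAt (hH : Continuous H) (hA : Continuous A) (θ : Param ℓ L) :
    Continuous (lossAt ℓ L H A θ) := by
  have hN : Continuous fun p : Layer ℓ 0 × Layer ℓ L => realization ℓ A θ p.1 L :=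
    (continuous_realization hA L).comp (continuous_const.prodMk continuous_fst)
  exact hH.comp (hN.prodMk (continuous_snd.prodMk continuous_const))

/-- The integrable function of the data point that dominates the derivative of the loss, see
`exists_bound_dLoss`: the denominator of the growth condition for `X = 0` and `Θ = 0`. -/
def lossScale (H : Layer ℓ L × Layer ℓ L × Param ℓ L → ℝ) (p : Layer ℓ 0 × Layer ℓ L) : ℝ :=
  1 + |H (0, p.2, 0)|

theorem integrable_lossScale [IsFiniteMeasure μ] (hL : 0 < L)
    (hint : ∀ A : ℝ → ℝ, Continuous A → ∀ θ : Param ℓ L, Integrable (lossAt ℓ L H A θ) μ) :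
    Integrable (lossScale H) μ := by
  obtain ⟨k, rfl⟩ := Nat.exists_eq_succ_of_ne_zero hL.ne'
  have hzero : ∀ x, realization ℓ id (0 : Param ℓ (k + 1)) x (k + 1) = 0 := fun x => by
    ext i
    simp [realization_succ, affineLayer, entry]
  have hval : lossAt ℓ (k + 1) H id 0 = fun p => H (0, p.2, 0) := funext fun p => by
    rw [lossAt, hzero]
  have hloss := hint id continuous_id 0
  rw [hval] at hloss
  exact (integrable_const 1).add hloss.abs

theorem norm_dLoss_le (hH : ContDiff ℝ 1 H) (A a : ℝ → ℝ) (θ : Param ℓ L)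
    (p : Layer ℓ 0 × Layer ℓ L) :
    ‖dLoss ℓ L H A a θ p‖ ≤
      ‖∇ (fun x' => H (x', p.2, θ)) (realization ℓ A θ p.1 L)‖ * ‖dRealization ℓ A a θ p.1 L‖ +
        ‖∇ (fun θ' => H (realization ℓ A θ p.1 L, p.2, θ')) θ‖ := by
  refine ContinuousLinearMap.opNorm_le_bound _ (by positivity) fun v => ?_
  refine (norm_fderiv_apply_le_norm_gradient (hH.differentiable one_ne_zero _)
    (dRealization ℓ A a θ p.1 L v) v).trans ?_
  rw [add_mul, mul_assoc]
  gcongr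
  exact ContinuousLinearMap.le_opNorm _ _

theorem exists_bound_dLoss (hμ : Bornology.IsBounded {x | ∃ y, (x, y) ∈ μ.support})
    (hH : ContDiff ℝ 1 H) (hgrowth : GradGrowth ℓ L H μ) (b : ℝ → ℝ) (r : ℝ) :
    ∃ C : ℝ, ∀ A a : ℝ → ℝ, HasLocalBound b A → HasLocalBound b a →
      ∀ θ : Param ℓ L, ‖θ‖ ≤ r → ∀ p ∈ μ.support, ‖dLoss ℓ L H A a θ p‖ ≤ C * lossScale H p := by
  obtain ⟨r', hr'⟩ := hμ.exists_norm_le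
  obtain ⟨B, hB⟩ := exists_bound_realization (ℓ := ℓ) (d := paramDim ℓ L) b (max r r') L
  set R := max (max r B) 1
  obtain ⟨C, hC⟩ := hgrowth R (by positivity) 0 0 (fun i => by simp [R]) (fun i => by simp [R])
  refine ⟨C * max B 1, fun A a hA ha θ hθ p hp => ?_⟩
  obtain ⟨hN, hD⟩ := hB A a hA ha θ p.1 (le_max_of_le_left hθ)
    (le_max_of_le_right (hr' _ ⟨p.2, hp⟩))
  have hgrad := (div_le_iff₀ (by positivity)).1 <| hC (realization ℓ A θ p.1 L) p.1 p.2 θ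
    (fun j => (PiLp.norm_apply_le _ j).trans (le_max_of_le_left (le_max_of_le_right hN)))
    (fun j => (PiLp.norm_apply_le θ j).trans (le_max_of_le_left (le_max_of_le_left hθ))) hp
  set u := ‖∇ (fun x' => H (x', p.2, θ)) (realization ℓ A θ p.1 L)‖
  set v := ‖∇ (fun θ' => H (realization ℓ A θ p.1 L, p.2, θ')) θ‖
  calc ‖dLoss ℓ L H A a θ p‖ ≤ u * ‖dRealization ℓ A a θ p.1 L‖ + v := norm_dLoss_le hH A a θ p
    _ ≤ u * max B 1 + v * max B 1 := by
      gcongr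
      · exact le_max_of_le_left hD
      · exact le_mul_of_one_le_right (norm_nonneg _) (le_max_right B 1)
    _ = (u + v) * max B 1 := (add_mul _ _ _).symm
    _ ≤ C * lossScale H p * max B 1 := by gcongr; exact hgrad
    _ = C * max B 1 * lossScale H p := mul_right_comm _ _ _

end Loss

section BiasShift

variable {ℓ : ℕ → ℕ} {d : ℕ}

theorem realization_congr_entry (A : ℝ → ℝ) {θ θ' : EuclideanSpace ℝ (Fin d)} (x : Layer ℓ 0)
    (k : ℕ) (h : ∀ n < paramDim ℓ k, entry θ n = entry θ' n) :
    realization ℓ A θ x k = realization ℓ A θ' x k := by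
  induction k with
  | zero => rfl
  | succ k ih =>
    have hle := paramDim_succ_le ℓ k.lt_succ_self
    rw [realization_succ, realization_succ, ih fun n hn => h n (by lia)]
    ext i
    simp only [affineLayer, h _ (biasIdx_lt ℓ k.lt_succ_self i),
      h _ (weightIdx_lt ℓ k.lt_succ_self i _)]

/-- The direction that moves all biases of layer `k + 1` by the same amount, and no parameter that
precedes these. -/
def biasShift (ℓ : ℕ → ℕ) (d k : ℕ) : EuclideanSpace ℝ (Fin d) :=
  WithLp.toLp 2 fun n => if paramDim ℓ k + ℓ (k + 1) * ℓ k ≤ n then 1 else 0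

theorem entry_add_smul_biasShift_of_lt (θ : EuclideanSpace ℝ (Fin d)) (t : ℝ) {k n : ℕ}
    (hn : n < paramDim ℓ k + ℓ (k + 1) * ℓ k) :
    entry (θ + t • biasShift ℓ d k) n = entry θ n := by
  unfold entry biasShift
  split_ifs
  · simp [not_le.2 hn]
  · rfl

theorem entry_add_smul_biasShift_of_le (θ : EuclideanSpace ℝ (Fin d)) (t : ℝ) {k n : ℕ}
    (hn : paramDim ℓ k + ℓ (k + 1) * ℓ k ≤ n) (hd : n < d) :
    entry (θ + t • biasShift ℓ d k) n = entry θ n + t := by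
  simp [entry, biasShift, hn, hd]

theorem realization_add_smul_biasShift_of_le (A : ℝ → ℝ) (θ : EuclideanSpace ℝ (Fin d))
    (x : Layer ℓ 0) (t : ℝ) {j k : ℕ} (hj : j ≤ k) :
    realization ℓ A (θ + t • biasShift ℓ d k) x j = realization ℓ A θ x j := by
  refine realization_congr_entry A x j fun n hn => entry_add_smul_biasShift_of_lt θ t ?_
  have hle : paramDim ℓ j ≤ paramDim ℓ k := Finset.sum_le_sum_of_subset (Finset.range_mono hj)
  lia

theorem realization_add_smul_biasShift_succ {L : ℕ} (A : ℝ → ℝ) (θ : Param ℓ L)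
    (x : Layer ℓ 0) (t : ℝ) {k : ℕ} (hk : k < L) (i : Fin (ℓ (k + 1))) :
    realization ℓ A (θ + t • biasShift ℓ _ k) x (k + 1) i =
      realization ℓ A θ x (k + 1) i + t := by
  have hweight : ∀ j : Fin (ℓ k), weightIdx ℓ k i j < paramDim ℓ k + ℓ (k + 1) * ℓ k := fun j => by
    have hi := i.isLt
    have hj := j.isLt
    unfold weightIdx
    nlinarith
  have hbias : paramDim ℓ k + ℓ (k + 1) * ℓ k ≤ biasIdx ℓ k i := by
    unfold biasIdx
    lia
  rw [realization_succ, realization_succ, realization_add_smul_biasShift_of_le A θ x t le_rfl]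
  simp only [affineLayer, entry_add_smul_biasShift_of_le θ t hbias (biasIdx_lt ℓ hk i),
    entry_add_smul_biasShift_of_lt θ t (hweight _)]
  ring

end BiasShift

section Generic

variable {ℓ : ℕ → ℕ} {L : ℕ} {μ : Measure (Layer ℓ 0 × Layer ℓ L)} {g : ℝ → ℝ} {S : Set ℝ}

/-- At a generic parameter `θ` almost no data point makes a neuron of the layers `1, …, L` take a
value in the exceptional set `S`. -/
def IsGeneric (ℓ : ℕ → ℕ) (L : ℕ) (μ : Measure (Layer ℓ 0 × Layer ℓ L)) (g : ℝ → ℝ) (S : Set ℝ)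
    (θ : Param ℓ L) : Prop :=
  ∀ᵐ p ∂μ, ∀ k < L, ∀ i : Fin (ℓ (k + 1)), realization ℓ g θ p.1 (k + 1) i ∉ S

theorem continuous_realization_apply (hg : Continuous g) (k : ℕ) (i : Fin (ℓ k)) :
    Continuous fun q : Param ℓ L × Layer ℓ 0 => realization ℓ g q.1 q.2 k i :=
  (EuclideanSpace.proj i).continuous.comp (continuous_realization hg k)

theorem ae_realization_succ_notMem (hg : Continuous g) (hS : S.Countable) (x : Layer ℓ 0) {k : ℕ}
    (hk : k < L) (i : Fin (ℓ (k + 1))) :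
    ∀ᵐ θ : Param ℓ L, realization ℓ g θ x (k + 1) i ∉ S := by
  have hcont : Continuous fun θ : Param ℓ L => realization ℓ g θ x (k + 1) i :=
    (continuous_realization_apply hg (k + 1) i).comp (.prodMk_left x)
  refine ae_mem_of_ae_add_linearMap_mem
    (LinearMap.toSpanSingleton ℝ (Param ℓ L) (biasShift ℓ _ k)) volume volume
    (hcont.measurable hS.measurableSet.compl) fun θ => ?_
  have hcount : ((realization ℓ g θ x (k + 1) i + ·) ⁻¹' S).Countable :=
    hS.preimage (add_right_injective _)
  filter_upwards [hcount.ae_notMem volume] with t ht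
  change realization ℓ g (θ + t • biasShift ℓ _ k) x (k + 1) i ∉ S
  rwa [realization_add_smul_biasShift_succ g θ x t hk i]

theorem ae_isGeneric [SFinite μ] (hg : Continuous g) (hS : S.Countable) :
    ∀ᵐ θ, IsGeneric ℓ L μ g S θ := by
  have hmeas : MeasurableSet {q : Param ℓ L × Layer ℓ 0 × Layer ℓ L |
      ∀ k < L, ∀ i : Fin (ℓ (k + 1)), realization ℓ g q.1 q.2.1 (k + 1) i ∉ S} := by
    simp only [Set.ofPred_forall]
    refine .iInter fun k => .iInter fun _ => .iInter fun i => ?_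
    exact ((continuous_realization_apply hg (k + 1) i).comp
      (by fun_prop : Continuous fun q : Param ℓ L × Layer ℓ 0 × Layer ℓ L =>
        (q.1, q.2.1))).measurable hS.measurableSet.compl
  exact (Measure.ae_ae_comm hmeas).2 <| .of_forall fun p => ae_all_iff.2 fun k =>
    ae_all_iff.2 fun hk => ae_all_iff.2 fun i => ae_realization_succ_notMem hg hS p.1 hk i

/-- The parameters for which, on the inputs in `K`, all neurons of the layers `1, …, k` have moved
strictly from their values at `θ` in the direction given by the sign of `σ`. -/
def shiftedParams (g : ℝ → ℝ) (σ : ℝ) (K : Set (Layer ℓ 0)) (θ : Param ℓ L) (k : ℕ) :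
    Set (Param ℓ L) :=
  {θ' | ∀ m < k, ∀ i : Fin (ℓ (m + 1)), ∀ x ∈ K,
    σ * realization ℓ g θ x (m + 1) i < σ * realization ℓ g θ' x (m + 1) i}

variable {σ : ℝ} {K : Set (Layer ℓ 0)}

theorem isOpen_setOf_lt_mul_realization (hg : Continuous g) (hK : IsCompact K)
    {f : Layer ℓ 0 → ℝ} (hf : Continuous f) (σ : ℝ) (k : ℕ) (i : Fin (ℓ k)) :
    IsOpen {θ : Param ℓ L | ∀ x ∈ K, f x < σ * realization ℓ g θ x k i} := by
  refine isOpen_iff_mem_nhds.2 fun θ hθ => hK.eventually_forall_of_forall_eventually fun x hx => ?_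
  have hfst : Continuous fun q : Param ℓ L × Layer ℓ 0 => f q.2 := hf.comp continuous_snd
  exact (hfst.continuousAt.eventually_lt
    ((continuous_realization_apply hg k i).const_mul σ).continuousAt (hθ x hx))

theorem continuous_realization_input (hg : Continuous g) (θ : Param ℓ L) (k : ℕ) (i : Fin (ℓ k)) :
    Continuous fun x => realization ℓ g θ x k i :=
  (continuous_realization_apply hg k i).comp (.prodMk_right θ)

theorem isOpen_shiftedParams (hg : Continuous g) (hK : IsCompact K) (σ : ℝ) (θ : Param ℓ L)
    (k : ℕ) : IsOpen (shiftedParams g σ K θ k) := by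
  simp only [shiftedParams, Set.ofPred_forall]
  refine (Set.finite_lt_nat k).isOpen_biInter fun m _ => isOpen_iInter_of_finite fun i => ?_
  simp only [← Set.ofPred_forall]
  exact isOpen_setOf_lt_mul_realization hg hK
    ((continuous_realization_input hg θ (m + 1) i).const_mul σ) σ (m + 1) i

theorem mem_closure_shiftedParams (hg : Continuous g) (hK : IsCompact K) (hσ : σ ≠ 0)
    (θ : Param ℓ L) {k : ℕ} (hk : k ≤ L) : θ ∈ closure (shiftedParams g σ K θ k) := by
  induction k with
  | zero => exact subset_closure fun m hm => absurd hm m.not_lt_zero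
  | succ k ih =>
    have hshift : ∀ t : ℝ, 0 < t →
        θ + (σ * t) • biasShift ℓ _ k ∈ closure (shiftedParams g σ K θ (k + 1)) := fun t ht => by
      have hσt : 0 < σ * (σ * t) := by
        rw [← mul_assoc]
        exact mul_pos (mul_self_pos.2 hσ) ht
      -- Parameters that change layer `k + 1` by less than the shift of its biases.
      let V : Set (Param ℓ L) := {θ' | ∀ i, ∀ x ∈ K,
        σ * realization ℓ g θ x (k + 1) i - σ * (σ * t) < σ * realization ℓ g θ' x (k + 1) i}
      have hV : IsOpen V := by
        rw [show V = _ from Set.ofPred_forall _]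
        refine isOpen_iInter_of_finite fun i => ?_
        exact isOpen_setOf_lt_mul_realization hg hK (((continuous_realization_input hg θ (k + 1)
          i).const_mul σ).sub continuous_const) σ (k + 1) i
      have hθV : θ ∈ V := fun i x _ => sub_lt_self _ hσt
      have hθ : θ ∈ closure (V ∩ shiftedParams g σ K θ k) :=
        hV.inter_closure ⟨hθV, ih (Nat.le_of_succ_le hk)⟩
      refine map_mem_closure (f := fun θ' => θ' + (σ * t) • biasShift ℓ _ k) (by fun_prop) hθ ?_
      rintro θ' ⟨hθ'V, hθ'⟩ m hm i x hx
      rcases Nat.lt_succ_iff_lt_or_eq.1 hm with hm | rfl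
      · rw [realization_add_smul_biasShift_of_le g θ' x _ hm]
        exact hθ' m hm i x hx
      · rw [realization_add_smul_biasShift_succ g θ' x _ hk i, mul_add]
        exact sub_lt_iff_lt_add.1 (hθ'V i x hx)
    have hlim : Tendsto (fun t : ℝ => θ + (σ * t) • biasShift ℓ (paramDim ℓ L) k) (𝓝[>] 0)
        (𝓝 θ) := by
      have hcont : Continuous fun t : ℝ => θ + (σ * t) • biasShift ℓ (paramDim ℓ L) k := by
        fun_prop
      simpa using (hcont.tendsto 0).mono_left nhdsWithin_le_nhds
    exact isClosed_closure.mem_of_tendsto hlim (eventually_mem_nhdsWithin.mono hshift)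

theorem exists_seq_isGeneric_shiftedParams [SFinite μ] (hg : Continuous g) (hS : S.Countable)
    (hK : IsCompact K) (hσ : σ ≠ 0) (θ : Param ℓ L) :
    ∃ θs : ℕ → Param ℓ L, (∀ n, IsGeneric ℓ L μ g S (θs n) ∧ θs n ∈ shiftedParams g σ K θ L) ∧
      Tendsto θs atTop (𝓝 θ) := by
  have hdense : Dense {θ | IsGeneric ℓ L μ g S θ} := Measure.dense_of_ae (ae_isGeneric hg hS)
  have hsub := hdense.open_subset_closure_inter (isOpen_shiftedParams hg hK σ θ L)
  obtain ⟨θs, hθs, hlim⟩ := mem_closure_iff_seq_limit.1 <|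
    closure_minimal hsub isClosed_closure (mem_closure_shiftedParams hg hK hσ θ le_rfl)
  exact ⟨θs, fun n => (hθs n).symm, hlim⟩

end Generic

section Risk

variable {ℓ : ℕ → ℕ} {L : ℕ} {H : Layer ℓ L × Layer ℓ L × Param ℓ L → ℝ}
  {μ : Measure (Layer ℓ 0 × Layer ℓ L)} {S : Finset ℝ} {σ w : ℝ} {g a : ℝ → ℝ} {A : ℕ → ℝ → ℝ}
  {θ : Param ℓ L}

/-- The standing assumptions on the number of layers, the distribution of the data, and the
integrand of the risk. -/
structure IsAdmissible (ℓ : ℕ → ℕ) (L : ℕ) (H : Layer ℓ L × Layer ℓ L × Param ℓ L → ℝ)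
    (μ : Measure (Layer ℓ 0 × Layer ℓ L)) : Prop where
  pos : 0 < L
  isBounded : Bornology.IsBounded {x | ∃ y, (x, y) ∈ μ.support}
  contDiff : ContDiff ℝ 1 H
  integrable : ∀ A : ℝ → ℝ, Continuous A → ∀ θ : Param ℓ L, Integrable (lossAt ℓ L H A θ) μ
  gradGrowth : GradGrowth ℓ L H μ

theorem IsApprox.eventually_forall_realization (h : IsApprox g a w A) (θ : Param ℓ L)
    (x : Layer ℓ 0) : ∀ᶠ n in atTop, ∀ m < L, ∀ j,
      g (realization ℓ g θ x m j) = A n (realization ℓ g θ x m j) ∧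
        a (realization ℓ g θ x m j) = deriv (A n) (realization ℓ g θ x m j) :=
  (eventually_all_finite (Set.finite_lt_nat L)).2 fun _ _ => eventually_all.2 fun _ =>
    (h.eventually _).mono fun _ hn => ⟨hn.1.symm, hn.2.symm⟩

theorem IsApprox.eventually_lossAt_eq (h : IsApprox g a w A) (θ : Param ℓ L)
    (p : Layer ℓ 0 × Layer ℓ L) : ∀ᶠ n in atTop, lossAt ℓ L H g θ p = lossAt ℓ L H (A n) θ p := by
  filter_upwards [h.eventually_forall_realization θ p.1] with n hn
  rw [lossAt, lossAt, realization_congr L fun m hm j => (hn m hm j).1]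

theorem IsApprox.tendsto_dLoss (h : IsApprox g a w A) (θ : Param ℓ L)
    (p : Layer ℓ 0 × Layer ℓ L) :
    Tendsto (fun n => dLoss ℓ L H (A n) (deriv (A n)) θ p) atTop (𝓝 (dLoss ℓ L H g a θ p)) := by
  refine tendsto_const_nhds.congr' ?_
  filter_upwards [h.eventually_forall_realization θ p.1] with n hn
  exact dLoss_congr (fun m hm j => (hn m hm j).1) fun m hm j => (hn m hm j).2

theorem continuous_dLoss_deriv {B : ℝ → ℝ} (hH : ContDiff ℝ 1 H) (hB : ContDiff ℝ 1 B)
    (θ : Param ℓ L) : Continuous (dLoss ℓ L H B (deriv B) θ) :=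
  continuous_dLoss hH hB.continuous (hB.continuous_deriv le_rfl) θ

theorem IsApprox.aestronglyMeasurable_dLoss (h : IsApprox g a w A) (hH : ContDiff ℝ 1 H)
    (θ : Param ℓ L) : AEStronglyMeasurable (dLoss ℓ L H g a θ) μ :=
  aestronglyMeasurable_of_tendsto_ae atTop
    (fun n => (continuous_dLoss_deriv hH (h.contDiff n) θ).aestronglyMeasurable)
    (.of_forall fun p => h.tendsto_dLoss θ p)

theorem IsApprox.exists_bound_dLoss (h : IsApprox g a w A) (hR : IsAdmissible ℓ L H μ)
    (hw : 0 < w) (r : ℝ) : ∃ C : ℝ, ∀ θ : Param ℓ L, ‖θ‖ ≤ r → ∀ p ∈ μ.support,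
      (∀ n, ‖dLoss ℓ L H (A n) (deriv (A n)) θ p‖ ≤ C * lossScale H p) ∧
        ‖dLoss ℓ L H g a θ p‖ ≤ C * lossScale H p := by
  obtain ⟨b, hb, hg, ha⟩ := h.exists_hasLocalBound hw
  obtain ⟨C, hC⟩ := DeepANN.exists_bound_dLoss hR.isBounded hR.contDiff hR.gradGrowth b r
  exact ⟨C, fun θ hθ p hp =>
    ⟨fun n => hC _ _ (hb n).1 (hb n).2 θ hθ p hp, hC _ _ hg ha θ hθ p hp⟩⟩

theorem IsApprox.exists_lipschitz_lossAt (h : IsApprox g a w A) (hR : IsAdmissible ℓ L H μ)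
    (hw : 0 < w) (r : ℝ) : ∃ C : ℝ, ∀ p ∈ μ.support, ∀ θ₁ θ₂ : Param ℓ L, ‖θ₁‖ ≤ r → ‖θ₂‖ ≤ r →
      ‖lossAt ℓ L H g θ₁ p - lossAt ℓ L H g θ₂ p‖ ≤ C * lossScale H p * ‖θ₁ - θ₂‖ := by
  obtain ⟨C, hC⟩ := h.exists_bound_dLoss hR hw r
  refine ⟨C, fun p hp θ₁ θ₂ h₁ h₂ => ?_⟩
  obtain ⟨n, hn₁, hn₂⟩ := ((h.eventually_lossAt_eq (H := H) θ₁ p).and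
    (h.eventually_lossAt_eq (H := H) θ₂ p)).exists
  have hderiv : ∀ θ : Param ℓ L, HasFDerivAt (fun θ' => lossAt ℓ L H (A n) θ' p)
      (dLoss ℓ L H (A n) (deriv (A n)) θ p) θ := fun θ =>
    hasFDerivAt_lossAt hR.contDiff fun _ _ _ _ =>
      ((h.contDiff n).differentiable one_ne_zero _).hasDerivAt
  rw [hn₁, hn₂]
  exact (convex_closedBall (0 : Param ℓ L) r).norm_image_sub_le_of_norm_hasFDerivWithin_le
    (fun θ _ => (hderiv θ).hasFDerivWithinAt)
    (fun θ hθ => (hC θ (mem_closedBall_zero_iff.1 hθ) p hp).1 n)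
    (mem_closedBall_zero_iff.2 h₂) (mem_closedBall_zero_iff.2 h₁)

variable [IsFiniteMeasure μ]

theorem IsAdmissible.integrable_lossScale (hR : IsAdmissible ℓ L H μ) :
    Integrable (lossScale H) μ :=
  DeepANN.integrable_lossScale hR.pos hR.integrable

theorem IsApprox.tendsto_integral_dLoss (h : IsApprox g a w A) (hR : IsAdmissible ℓ L H μ)
    (hw : μ.support.Finite ∨ 0 < w) (θ : Param ℓ L) :
    Tendsto (fun n => ∫ p, dLoss ℓ L H (A n) (deriv (A n)) θ p ∂μ) atTop
      (𝓝 (∫ p, dLoss ℓ L H g a θ p ∂μ)) := by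
  refine tendsto_integral_of_finite_support_or_dominated
    (fun n => (continuous_dLoss_deriv hR.contDiff (h.contDiff n) θ).aestronglyMeasurable)
    hR.integrable_lossScale (fun p _ => h.tendsto_dLoss θ p) (hw.imp_right fun hw => ?_)
  obtain ⟨C, hC⟩ := h.exists_bound_dLoss hR hw ‖θ‖
  exact ⟨C, fun n p hp => (hC θ le_rfl p hp).1 n⟩

theorem IsApprox.tendsto_integral_dLoss_of_tendsto (h : IsApprox g a w A)
    (hR : IsAdmissible ℓ L H μ) (hw : μ.support.Finite ∨ 0 < w) (hg : Continuous g)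
    {θs : ℕ → Param ℓ L} (hθ : Tendsto θs atTop (𝓝 θ))
    (ha : ∀ p ∈ μ.support, ∀ k < L, ∀ i : Fin (ℓ (k + 1)),
      Tendsto (fun n => a (realization ℓ g (θs n) p.1 (k + 1) i)) atTop
        (𝓝 (a (realization ℓ g θ p.1 (k + 1) i)))) :
    Tendsto (fun n => ∫ p, dLoss ℓ L H g a (θs n) p ∂μ) atTop
      (𝓝 (∫ p, dLoss ℓ L H g a θ p ∂μ)) := by
  refine tendsto_integral_of_finite_support_or_dominated
    (fun n => h.aestronglyMeasurable_dLoss hR.contDiff (θs n)) hR.integrable_lossScale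
    (fun p hp => ?_) (hw.imp_right fun hw => ?_)
  · refine DeepANN.tendsto_dLoss hR.contDiff hg (hθ.prodMk_nhds tendsto_const_nhds) fun m hm j => ?_
    rcases m with _ | k
    · exact tendsto_const_nhds
    · exact ha p hp k (Nat.lt_of_succ_lt hm) j
  · obtain ⟨r, hr⟩ := hθ.norm.bddAbove_range
    obtain ⟨C, hC⟩ := h.exists_bound_dLoss hR hw r
    exact ⟨C, fun n p hp => (hC (θs n) (hr ⟨n, rfl⟩) p hp).2⟩

theorem hasFDerivAt_risk_of_isGeneric (h : IsApprox g a w A) (hR : IsAdmissible ℓ L H μ)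
    (hw : μ.support.Finite ∨ 0 < w) (hS : IsOneSidedDeriv S σ g a)
    (hθ : IsGeneric ℓ L μ g S θ) :
    HasFDerivAt (risk ℓ L H μ g) (∫ p, dLoss ℓ L H g a θ p ∂μ) θ := by
  have hderiv : ∀ᵐ p ∂μ,
      HasFDerivAt (fun θ' => lossAt ℓ L H g θ' p) (dLoss ℓ L H g a θ p) θ := by
    filter_upwards [hθ] with p hp
    refine hasFDerivAt_lossAt hR.contDiff fun m hm hm0 j => ?_
    obtain ⟨k, rfl⟩ := Nat.exists_eq_succ_of_ne_zero hm0
    exact hS.hasDerivAt _ (hp k (Nat.lt_of_succ_lt hm) j)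
  rcases hw with hfin | hw
  · exact hasFDerivAt_integral_of_finite_support hfin hderiv
  · obtain ⟨C, hC⟩ := h.exists_lipschitz_lossAt hR hw (‖θ‖ + 1)
    have hball : ∀ θ' ∈ Metric.ball θ 1, ‖θ'‖ ≤ ‖θ‖ + 1 := fun θ' hθ' =>
      (norm_lt_of_mem_ball hθ').le
    refine (hasFDerivAt_integral_of_dominated_loc_of_lip (F := lossAt ℓ L H g)
      (Metric.ball_mem_nhds θ one_pos) (bound := fun p => C * lossScale H p)
      (.of_forall fun θ' =>
        (continuous_lossAt hR.contDiff.continuous hS.continuous θ').aestronglyMeasurable)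
      (hR.integrable g hS.continuous θ) (h.aestronglyMeasurable_dLoss hR.contDiff θ) ?_
      (hR.integrable_lossScale.const_mul C) hderiv).2
    filter_upwards [Measure.support_mem_ae (μ := μ)] with p hp
    refine LipschitzOnWith.of_dist_le_mul fun θ₁ h₁ θ₂ h₂ => ?_
    rw [dist_eq_norm, dist_eq_norm, Real.coe_nnabs]
    exact (hC p hp θ₁ θ₂ (hball θ₁ h₁) (hball θ₂ h₂)).trans
      (mul_le_mul_of_nonneg_right (le_abs_self _) (norm_nonneg _))

theorem hasFDerivAt_risk_of_contDiff (hR : IsAdmissible ℓ L H μ) {B : ℝ → ℝ}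
    (hB : ContDiff ℝ 1 B) (θ : Param ℓ L) :
    HasFDerivAt (risk ℓ L H μ B) (∫ p, dLoss ℓ L H B (deriv B) θ p ∂μ) θ :=
  hasFDerivAt_risk_of_isGeneric (isApprox_const hB) hR (.inr one_pos) (isOneSidedDeriv_deriv hB)
    (.of_forall fun _ _ _ _ => by simp)

theorem contDiff_risk (hR : IsAdmissible ℓ L H μ) {B : ℝ → ℝ} (hB : ContDiff ℝ 1 B) :
    ContDiff ℝ 1 (risk ℓ L H μ B) := by
  have hderiv := hasFDerivAt_risk_of_contDiff hR hB
  refine contDiff_one_iff_fderiv.2 ⟨fun θ => (hderiv θ).differentiableAt, ?_⟩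
  rw [funext fun θ => (hderiv θ).fderiv]
  refine continuous_iff_continuousAt.2 fun θ => tendsto_of_seq_tendsto fun θs hθs => ?_
  refine (isApprox_const hB).tendsto_integral_dLoss_of_tendsto hR (.inr one_pos) hB.continuous hθs
    fun p _ k _ i => ?_
  have hcont : Continuous fun θ : Param ℓ L => realization ℓ B θ p.1 (k + 1) i :=
    (continuous_realization_apply hB.continuous (k + 1) i).comp (.prodMk_left p.1)
  exact (((hB.continuous_deriv le_rfl).comp hcont).tendsto θ).comp hθs

end Risk

section GeneralizedGradient

variable {ℓ : ℕ → ℕ} {L : ℕ} {H : Layer ℓ L × Layer ℓ L × Param ℓ L → ℝ}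
  {μ : Measure (Layer ℓ 0 × Layer ℓ L)} [IsFiniteMeasure μ] {S : Finset ℝ} {σ w : ℝ}
  {g a : ℝ → ℝ} {A : ℕ → ℝ → ℝ}

/-- The generalized gradient `𝒢`: the gradient of the risk that backpropagation computes with the
function `a` in place of the derivative of the activation `g`. -/
def genGradient (ℓ : ℕ → ℕ) (L : ℕ) (H : Layer ℓ L × Layer ℓ L × Param ℓ L → ℝ)
    (μ : Measure (Layer ℓ 0 × Layer ℓ L)) (g a : ℝ → ℝ) (θ : Param ℓ L) : Param ℓ L :=
  (InnerProductSpace.toDual ℝ _).symm (∫ p, dLoss ℓ L H g a θ p ∂μ)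

theorem IsApprox.tendsto_gradient_risk (h : IsApprox g a w A) (hR : IsAdmissible ℓ L H μ)
    (hw : μ.support.Finite ∨ 0 < w) (θ : Param ℓ L) :
    Tendsto (fun n => ∇ (risk ℓ L H μ (A n)) θ) atTop (𝓝 (genGradient ℓ L H μ g a θ)) := by
  refine (((InnerProductSpace.toDual ℝ (Param ℓ L)).symm.continuous.tendsto _).comp
    (h.tendsto_integral_dLoss hR hw θ)).congr fun n => ?_
  rw [gradient, (hasFDerivAt_risk_of_contDiff hR (h.contDiff n) θ).fderiv]
  rfl

theorem isGenGradient_genGradient (hR : IsAdmissible ℓ L H μ) (hw : μ.support.Finite ∨ 0 < w) :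
    IsGenGradient ℓ L H μ g a w (genGradient ℓ L H μ g a) := fun θ _ h =>
  tendsto_iff_norm_sub_tendsto_zero.1 (h.tendsto_gradient_risk hR hw θ)

theorem IsApprox.eq_genGradient (h : IsApprox g a w A) (hR : IsAdmissible ℓ L H μ)
    (hw : μ.support.Finite ∨ 0 < w) {G : Param ℓ L → Param ℓ L}
    (hG : IsGenGradient ℓ L H μ g a w G) : G = genGradient ℓ L H μ g a :=
  funext fun θ => tendsto_nhds_unique (tendsto_iff_norm_sub_tendsto_zero.2 (hG θ A h))
    (h.tendsto_gradient_risk hR hw θ)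

theorem exists_seq_hasGradientAt_risk (h : IsApprox g a w A) (hR : IsAdmissible ℓ L H μ)
    (hw : μ.support.Finite ∨ 0 < w) (hS : IsOneSidedDeriv S σ g a) (θ : Param ℓ L) :
    ∃ θs : ℕ → Param ℓ L,
      (∀ n, HasGradientAt (risk ℓ L H μ g) (genGradient ℓ L H μ g a (θs n)) (θs n)) ∧
      Tendsto θs atTop (𝓝 θ) ∧
      Tendsto (fun n => genGradient ℓ L H μ g a (θs n)) atTop (𝓝 (genGradient ℓ L H μ g a θ)) := by
  obtain ⟨r, hr⟩ := hR.isBounded.exists_norm_le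
  obtain ⟨θs, hθs, hlim⟩ := exists_seq_isGeneric_shiftedParams (μ := μ) hS.continuous
    S.countable_toSet (isCompact_closedBall (0 : Layer ℓ 0) r) hS.sign_ne_zero θ
  refine ⟨θs, fun n => hasFDerivAt_iff_hasGradientAt.1
    (hasFDerivAt_risk_of_isGeneric h hR hw hS (hθs n).1), hlim, ?_⟩
  refine ((InnerProductSpace.toDual ℝ (Param ℓ L)).symm.continuous.tendsto _).comp <|
    h.tendsto_integral_dLoss_of_tendsto hR hw hS.continuous hlim fun p hp k hk i => ?_
  have hcont : Continuous fun θ : Param ℓ L => realization ℓ g θ p.1 (k + 1) i :=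
    (continuous_realization_apply hS.continuous (k + 1) i).comp (.prodMk_left p.1)
  refine (hS.continuousWithinAt _).tendsto.comp <|
    tendsto_nhdsWithin_iff.2 ⟨(hcont.tendsto θ).comp hlim, .of_forall fun n => ?_⟩
  have hshift := (hθs n).2 k hk i p.1 (mem_closedBall_zero_iff.2 (hr _ ⟨p.2, hp⟩))
  exact (sub_pos.2 hshift).trans_eq (mul_sub _ _ _).symm

end GeneralizedGradient

end DeepANN

end

theorem theoremX (L : ℕ) (hL : 0 < L) (ℓ : ℕ → ℕ) (hℓ : ∀ k ≤ L, 0 < ℓ k)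
    (μ : Measure (DeepANN.Layer ℓ 0 × DeepANN.Layer ℓ L)) [IsFiniteMeasure μ]
    (hμ : Bornology.IsBounded {x | ∃ y, (x, y) ∈ μ.support})
    (H : DeepANN.Layer ℓ L × DeepANN.Layer ℓ L × DeepANN.Param ℓ L → ℝ)
    (hH : ContDiff ℝ 1 H)
    (hint : ∀ A : ℝ → ℝ, Continuous A → ∀ θ : DeepANN.Param ℓ L,
      Integrable (DeepANN.lossAt ℓ L H A θ) μ)
    (hgrowth : DeepANN.GradGrowth ℓ L H μ)
    (S : Finset ℝ) (g : ℝ → ℝ) (hg : Continuous g) (hgS : ContDiffOn ℝ 1 g (↑S : Set ℝ)ᶜ)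
    (a : ℝ → ℝ) (ha : ∀ x ∉ S, a x = deriv g x)
    (hosc : min (DeepANN.oneSidedOsc a S (-1)) (DeepANN.oneSidedOsc a S 1) = 0)
    (z : ℕ)
    (hbdd : ∀ m : ℕ, ∃ C : ℝ, ∀ x ∈ Set.Icc (-(m : ℝ)) m,
      |a x| * DeepANN.boundWeight z μ ≤ C) :
    (∀ A : ℝ → ℝ, ContDiff ℝ 1 A → ContDiff ℝ 1 (DeepANN.risk ℓ L H μ A)) ∧
    (∃! G : DeepANN.Param ℓ L → DeepANN.Param ℓ L,
      DeepANN.IsGenGradient ℓ L H μ g a (DeepANN.boundWeight z μ) G) ∧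
    (∀ G : DeepANN.Param ℓ L → DeepANN.Param ℓ L,
      DeepANN.IsGenGradient ℓ L H μ g a (DeepANN.boundWeight z μ) G →
      (∀ θ, G θ ∈ DeepANN.limitingSubgradients (DeepANN.risk ℓ L H μ g) θ) ∧
      (∀ U : Set (DeepANN.Param ℓ L), IsOpen U → ContDiffOn ℝ 1 (DeepANN.risk ℓ L H μ g) U →
        ∀ θ ∈ U, HasGradientAt (DeepANN.risk ℓ L H μ g) (G θ) θ)) := by
  open DeepANN in
  have hR : IsAdmissible ℓ L H μ := ⟨hL, hμ, hH, hint, hgrowth⟩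
  have hw : μ.support.Finite ∨ 0 < boundWeight z μ :=
    or_iff_not_imp_left.2 fun h => boundWeight_pos_of_infinite_support h z
  obtain ⟨σ, hS⟩ := exists_isOneSidedDeriv hg hgS ha hosc
  obtain ⟨A, hA⟩ := hS.exists_isApprox (boundWeight_nonneg z μ) <|
    (boundWeight_nonneg z μ).eq_or_lt.imp Eq.symm fun h => exists_hasLocalBound_of_mul_le h hbdd
  have hunique : ∀ G, IsGenGradient ℓ L H μ g a (boundWeight z μ) G →
      G = genGradient ℓ L H μ g a := fun _ => hA.eq_genGradient hR hw
  refine ⟨fun B hB => contDiff_risk hR hB,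
    ⟨genGradient ℓ L H μ g a, isGenGradient_genGradient hR hw, hunique⟩, fun G hG => ?_⟩
  obtain rfl := hunique G hG
  refine ⟨fun θ => ?_, fun U hU hUdiff θ hθ => ?_⟩ <;>
    obtain ⟨θs, hgrad, hθs, hlim⟩ := exists_seq_hasGradientAt_risk hA hR hw hS θ
  · exact mem_limitingSubgradients_of_tendsto hgrad hθs hlim
  · exact hasGradientAt_of_tendsto hU hUdiff hθ hgrad hθs hlim
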